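/- Let $\lambda,w:\mathbb Z\to\mathbb C$ with $w_n\neq0$ for all $n$. Let $\operatorname{der}(\lambda)$ be the set of limits of convergent subsequences of $\lambda$, and put $\mathbb C_0^\lambda=\mathbb C\setminus\overline{\{\lambda_n : n\in\mathbb Z\}}$. Assume that $$\sum_{n\in\mathbb Z}\left|\frac{w_n^2}{(\lambda_n-z_0)(\lambda_{n+1}-z_0)}\right|<\infty\quad\text{for at least one } z_0\in\mathbb C_0^\lambda .$$ Let $\gamma:\mathbb Z\to\mathbb C$ be any sequence with $\gamma_n\gamma_{n+1}=w_n$ for all $n$, and for $z\in\mathbb C_0^\lambda$ let $$F(z)=\mathfrak F\!\left(\Big\{\tfrac{\gamma_n^2}{z-\lambda_n}\Big\}_{n\in\mathbb Z}\right),\qquad \mathfrak F(x)=1+\sum_{m=1}^\infty(-1)^m\sum_{k_1=-\infty}^{\infty}\ \sum_{k_2=k_1+2}^{\infty}\cdots\sum_{k_m=k_{m-1}+2}^{\infty}\ \prod_{j=1}^m x_{k_j}x_{k_j+1}.$$ Assume that $F$ does not vanish identically on $\mathbb C_0^\lambda$ and that $\mathbb C\setminus\operatorname{der}(\lambda)$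 is connected. For a sequence $x:\mathbb Z\to\mathbb C$ put $(\mathcal Jx)_n=w_{n-1}x_{n-1}+\lambda_nx_n+w_nx_{n+1}$. Let $J_{\max}$ be the restriction of $\mathcal J$ to $\{x\in\ell^2(\mathbb Z):\mathcal Jx\in\ell^2(\mathbb Z)\}$, and let $J_{\min}$ be the closure in $\ell^2(\mathbb Z)$ of the restriction of $\mathcal J$ to the linear span of the standard basis. Suppose that $z\in\mathbb C_0^\lambda$ is an eigenvalue of $J_{\min}$ with an eigenvector $v\in\ell^2(\mathbb Z)\setminus\{0\}$ such that $$\sum_{n\in\mathbb Z}v_n^2=0 .$$ Then $J_{\min}=J_{\max}=:J$, the point $z$ is an isolated point of the spectrum of $J$, and the algebraic multiplicity of $z$ exceeds its geometric multiplicity, $\nu_a(z)>\nu_g(z)$. Here $\nu_g(z)=\dim\operatorname{Ker}(J-z)$ and $\nu_a(z)=\dim\operatorname{Ran}P_z$, where $$P_z=-\frac1{2\pi i}\oint_{|\xi-z|=r}(J-\xi)^{-1}\,d\xi$$ is the Riesz projection, the circle being positively oriented and $r>0$ being any radius such that the closed disc of radius $r$ about $z$ contains no point of the spectrum other than $z$.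 -/

import Mathlib

noncomputable section

namespace DoublyInfiniteJacobi

/-! ### The function `𝔉` and the characteristic function -/

/-- `𝔉(x) = 1 + ∑_{m ≥ 1} (-1)^m ∑_{k₁} ∑_{k₂ ≥ k₁ + 2} ⋯ ∑_{k_m ≥ k_{m-1} + 2} ∏_j x_{k_j} x_{k_j + 1}`.
The index tuple `k₁ < ⋯ < k_m` is recorded as the finite set `S = {k₁, …, k_m}`: the gaps are at
least two exactly when `S` contains no two consecutive integers (for `m = 0` the inner sum is `1`).
All sums converge absolutely when `∑ |x_k x_{k+1}| < ∞`. -/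
def frakF (x : ℤ → ℂ) : ℂ :=
  ∑' m : ℕ, (-1 : ℂ) ^ m *
    ∑' S : {S : Finset ℤ // S.card = m ∧ ∀ k ∈ S, k + 1 ∉ S}, ∏ k ∈ S.1, x k * x (k + 1)

/-- `ℂ₀^λ`, the complement of the closure of the range of `λ`. -/
def compl0 (lam : ℤ → ℂ) : Set ℂ := (closure (Set.range lam))ᶜ

/-- `der(λ)`, the set of limits of convergent subsequences of `λ`. -/
def der (lam : ℤ → ℂ) : Set ℂ := {z | MapClusterPt z Filter.cofinite lam}

/-- The convergence condition `∑_n |w_n² / ((λ_n - z₀)(λ_{n+1} - z₀))| < ∞`. -/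
def SummableAt (lam w : ℤ → ℂ) (z₀ : ℂ) : Prop :=
  Summable fun n : ℤ => ‖w n ^ 2 / ((lam n - z₀) * (lam (n + 1) - z₀))‖

/-- The characteristic function `F(z) = 𝔉({γ_n² / (z - λ_n)})`, where `γ_n γ_{n+1} = w_n`. -/
def charFun (lam γ : ℤ → ℂ) (z : ℂ) : ℂ := frakF fun n => γ n ^ 2 / (z - lam n)

/-! ### Unbounded operators: spectrum, resolvent, multiplicities -/

section Operators

variable {H : Type*} [NormedAddCommGroup H] [NormedSpace ℂ H]

/-- `R` is the bounded, everywhere defined two-sided inverse of `A - z`. -/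
def IsResolventAt (A : H →ₗ.[ℂ] H) (z : ℂ) (R : H →L[ℂ] H) : Prop :=
  (∀ y : H, ∃ h : R y ∈ A.domain, A ⟨R y, h⟩ - z • R y = y) ∧
    ∀ x : A.domain, R (A x - z • (x : H)) = x

/-- The resolvent set. -/
def resolventSet (A : H →ₗ.[ℂ] H) : Set ℂ := {z | ∃ R : H →L[ℂ] H, IsResolventAt A z R}

/-- The spectrum. -/
def spec (A : H →ₗ.[ℂ] H) : Set ℂ := (resolventSet A)ᶜ

open Classical in
/-- The resolvent `(A - z)⁻¹` for `z` in the resolvent set (and `0` elsewhere). -/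
def resolventOp (A : H →ₗ.[ℂ] H) (z : ℂ) : H →L[ℂ] H :=
  if h : ∃ R : H →L[ℂ] H, IsResolventAt A z R then h.choose else 0

/-- `Ker (A - z)`. -/
def eigenspace (A : H →ₗ.[ℂ] H) (z : ℂ) : Submodule ℂ H :=
  (LinearMap.ker (A.toFun - z • A.domain.subtype)).map A.domain.subtype

/-- The geometric multiplicity `ν_g(z) = dim Ker (A - z)`. -/
def geometricMultiplicity (A : H →ₗ.[ℂ] H) (z : ℂ) : Cardinal :=
  Module.rank ℂ (eigenspace A z)

/-- `z` is an isolated point of the spectrum. -/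
def IsIsolatedSpectralPoint (A : H →ₗ.[ℂ] H) (z : ℂ) : Prop :=
  z ∈ spec A ∧ ∃ ε > 0, Metric.ball z ε ∩ spec A ⊆ {z}

/-- The circle of radius `r` about `z` lies in the resolvent set and encloses no spectral point
other than `z`. -/
def IsRieszRadius (A : H →ₗ.[ℂ] H) (z : ℂ) (r : ℝ) : Prop :=
  0 < r ∧ Metric.closedBall z r ∩ spec A ⊆ {z}

/-- The Riesz projection `-(2πi)⁻¹ ∮ (A - ξ)⁻¹ dξ` over the positively oriented circle of
radius `r` about `z`. -/
def rieszProjection (A : H →ₗ.[ℂ] H) (z : ℂ) (r : ℝ) : H →L[ℂ] H :=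
  (-(2 * (Real.pi : ℂ) * Complex.I)⁻¹) • ∮ ξ in C(z, r), resolventOp A ξ

/-- The algebraic multiplicity `ν_a(z) = dim Ran P_z` of an isolated spectral point `z`, the Riesz
projection `P_z` being computed on the circle of radius `r` about `z`; for all `r` with
`IsRieszRadius A z r` it is the same. -/
def algebraicMultiplicity (A : H →ₗ.[ℂ] H) (z : ℂ) (r : ℝ) : Cardinal :=
  Module.rank ℂ (LinearMap.range (rieszProjection A z r).toLinearMap)

end Operators

/-! ### Jacobi operators -/

/-- The Hilbert space `ℓ²(ℤ)`. -/
abbrev EllTwo : Type := lp (fun _ : ℤ => ℂ) 2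

/-- The formal matrix action `(𝒥x)_n = w_{n-1} x_{n-1} + λ_n x_n + w_n x_{n+1}`. -/
def formalJacobi (lam w : ℤ → ℂ) : (ℤ → ℂ) →ₗ[ℂ] (ℤ → ℂ) where
  toFun x n := w (n - 1) * x (n - 1) + lam n * x n + w n * x (n + 1)
  map_add' x y := by ext n; simp only [Pi.add_apply]; ring
  map_smul' c x := by
    ext n; simp only [Pi.smul_apply, smul_eq_mul, RingHom.id_apply]; ring

/-- The maximal operator: `𝒥` on `{x ∈ ℓ²(ℤ) | 𝒥x ∈ ℓ²(ℤ)}`. -/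
def jacobiMax (lam w : ℤ → ℂ) : EllTwo →ₗ.[ℂ] EllTwo where
  domain :=
    { carrier := {x | Memℓp (formalJacobi lam w (x : ℤ → ℂ)) 2}
      add_mem' := fun {x y} hx hy => by
        have h := Memℓp.add hx hy
        rw [← map_add] at h
        exact h
      zero_mem' := by
        have h : formalJacobi lam w ((0 : EllTwo) : ℤ → ℂ) = 0 :=
          map_zero (formalJacobi lam w)
        change Memℓp (formalJacobi lam w ((0 : EllTwo) : ℤ → ℂ)) 2
        rw [h]
        exact zero_memℓp
      smul_mem' := fun c x hx => by
        have h := Memℓp.const_smul hx c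
        rw [← map_smul] at h
        exact h }
  toFun :=
    { toFun := fun x => ⟨formalJacobi lam w ((x : EllTwo) : ℤ → ℂ), x.2⟩
      map_add' := fun x y =>
        Subtype.ext (map_add (formalJacobi lam w) ((x : EllTwo) : ℤ → ℂ) ((y : EllTwo) : ℤ → ℂ))
      map_smul' := fun c x =>
        Subtype.ext (map_smul (formalJacobi lam w) c ((x : EllTwo) : ℤ → ℂ)) }

/-- The span of the standard basis vectors `e_n` of `ℓ²(ℤ)`. -/
def finiteSpan : Submodule ℂ EllTwo :=
  Submodule.span ℂ (Set.range fun n : ℤ => (lp.single 2 n (1 : ℂ) : EllTwo))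

/-- Every `e_n` lies in the domain of the maximal operator. -/
theorem finiteSpan_le_domain (lam w : ℤ → ℂ) : finiteSpan ≤ (jacobiMax lam w).domain := by
  refine Submodule.span_le.2 ?_
  rintro _ ⟨n, rfl⟩
  change Memℓp (formalJacobi lam w ((lp.single 2 n (1 : ℂ) : EllTwo) : ℤ → ℂ)) 2
  have hfin : (Function.support
      (formalJacobi lam w ((lp.single 2 n (1 : ℂ) : EllTwo) : ℤ → ℂ))).Finite := by
    refine (Set.finite_Icc (n - 1) (n + 1)).subset fun k hk => ?_
    by_contra hout
    apply hk
    have h1 : k - 1 ≠ n := fun h => hout (by rw [Set.mem_Icc]; omega)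
    have h2 : k ≠ n := fun h => hout (by rw [Set.mem_Icc]; omega)
    have h3 : k + 1 ≠ n := fun h => hout (by rw [Set.mem_Icc]; omega)
    simp [formalJacobi, h1, h2, h3]
  exact (memℓp_zero (by simpa [Function.support] using hfin)).of_exponent_ge (by simp)

/-- `J₀`, the restriction of `𝒥` to the span of the standard basis. -/
def jacobiZero (lam w : ℤ → ℂ) : EllTwo →ₗ.[ℂ] EllTwo :=
  (jacobiMax lam w).domRestrict finiteSpan

/-- The minimal operator, the closure of `J₀`. -/
def jacobiMin (lam w : ℤ → ℂ) : EllTwo →ₗ.[ℂ] EllTwo := (jacobiZero lam w).closure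

/-- The maximal operator is closed. -/
theorem jacobiMax_isClosed (lam w : ℤ → ℂ) : (jacobiMax lam w).IsClosed := by
  have hc : ∀ n : ℤ, Continuous fun x : EllTwo => (x : ℤ → ℂ) n := fun n =>
    (lp.evalCLM ℂ (fun _ : ℤ => ℂ) (p := 2) n).continuous
  have hset : ((jacobiMax lam w).graph : Set (EllTwo × EllTwo)) =
      {p | ∀ n : ℤ, formalJacobi lam w (p.1 : ℤ → ℂ) n = (p.2 : ℤ → ℂ) n} := by
    ext ⟨x, y⟩
    simp only [SetLike.mem_coe, LinearPMap.mem_graph_iff, Set.mem_ofPred_eq]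
    constructor
    · rintro ⟨a, rfl, rfl⟩ n
      rfl
    · intro h
      have h' : formalJacobi lam w (x : ℤ → ℂ) = (y : ℤ → ℂ) := funext h
      refine ⟨⟨x, ?_⟩, rfl, ?_⟩
      · change Memℓp (formalJacobi lam w (x : ℤ → ℂ)) 2
        rw [h']
        exact lp.memℓp y
      · exact Subtype.ext h'
  rw [LinearPMap.IsClosed, hset, Set.ofPred_forall]
  refine isClosed_iInter fun n => isClosed_eq ?_ ((hc n).comp continuous_snd)
  have h1 := (hc (n - 1)).comp (continuous_fst (X := EllTwo) (Y := EllTwo))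
  have h2 := (hc n).comp (continuous_fst (X := EllTwo) (Y := EllTwo))
  have h3 := (hc (n + 1)).comp (continuous_fst (X := EllTwo) (Y := EllTwo))
  exact ((h1.const_mul (w (n - 1))).add (h2.const_mul (lam n))).add (h3.const_mul (w n))

/-- `J₀` is closable, so that the minimal operator is its genuine closure. -/
theorem jacobiZero_isClosable (lam w : ℤ → ℂ) : (jacobiZero lam w).IsClosable :=
  (jacobiMax_isClosed lam w).isClosable.leIsClosable LinearPMap.domRestrict_le

end DoublyInfiniteJacobi

end

open Filter Topology

namespace DoublyInfiniteJacobi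

/-! ### Sums over sparse finite sets of integers -/

/-! Write t_n = w_n²/((z-λ_n)(z-λ_{n+1})), which is `edge`. Then F(z) is the sum over sparse finite
sets S of ∏_{k∈S}(-t_k). Cutting this sum at n yields solutions f and g of 𝒥y = zy that decay
exponentially at +∞ and -∞ and have Wronskian F(z) (`exists_weyl_solutions`). Where F(z) ≠ 0, the
Green kernel -g_{min}f_{max}/F(z) decays exponentially off the diagonal and defines a bounded
operator R (`exists_green_operator`).

The eigenvector v of J_min excludes the limit-circle case at both ends: if two independent solutions
were square-summable near an end, the vanishing of their Wronskians with v at that end would force v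
= 0. Hence an ℓ² solution h is proportional both to f and to g, so h = 0 when F ≠ 0
(`eq_zero_of_isSol`). It follows that R is the resolvent, that Ran(J_min - z) is dense, and that
J_min = J_max (`jacobiMin_eq_jacobiMax`). As F is analytic on the connected set ℂ₀^λ, its zeros are
isolated there, and so is the eigenvalue in the spectrum.

Two ℓ² eigenvectors have zero Wronskian, so the geometric multiplicity is 1. The matrix is symmetric
for the bilinear form ⟨x,y⟩ = ∑ x_n y_n, and therefore so is the Riesz projection P. If Ran P were
the line through v, then v_n = ⟨Pv,e_n⟩ = ⟨v,Pe_n⟩ would be a multiple of ⟨v,v⟩ = 0 for every n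
(`one_lt_rank_range_rieszProjection`). -/

/-- No two consecutive integers lie in `S`. -/
def Sparse (S : Finset ℤ) : Prop := ∀ k ∈ S, k + 1 ∉ S

open Classical in
/-- The term of `sparseSum` belonging to `S`. -/
noncomputable def sparseTerm (t : ℤ → ℂ) (S : Finset ℤ) : ℂ := if Sparse S then ∏ k ∈ S, -t k else 0

/-- `∑_S ∏_{k ∈ S} (-t_k)`, the sum being over the finite sets without consecutive elements. -/
noncomputable def sparseSum (t : ℤ → ℂ) : ℂ := ∑' S : Finset ℤ, sparseTerm t S

theorem norm_sparseTerm_le (t : ℤ → ℂ) (S : Finset ℤ) : ‖sparseTerm t S‖ ≤ ∏ k ∈ S, ‖t k‖ := by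
  unfold sparseTerm
  split_ifs
  · simp [norm_prod]
  · simpa using Finset.prod_nonneg fun k _ => norm_nonneg (t k)

theorem norm_sparseTerm_le_of_le {t : ℤ → ℂ} {u : ℤ → ℝ} (h : ∀ k, ‖t k‖ ≤ u k) (S : Finset ℤ) :
    ‖sparseTerm t S‖ ≤ ∏ k ∈ S, u k :=
  (norm_sparseTerm_le t S).trans (Finset.prod_le_prod (fun _ _ => norm_nonneg _) fun k _ => h k)

theorem summable_prod_norm {t : ℤ → ℂ} (ht : Summable fun k => ‖t k‖) :
    Summable fun S : Finset ℤ => ∏ k ∈ S, ‖t k‖ :=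
  summable_finsetProd_of_summable_nonneg (fun _ => norm_nonneg _) ht

theorem summable_sparseTerm {t : ℤ → ℂ} (ht : Summable fun k => ‖t k‖) :
    Summable (sparseTerm t) :=
  Summable.of_norm_bounded (summable_prod_norm ht) (norm_sparseTerm_le t)

theorem norm_sparseSum_le {t s : ℤ → ℂ} (ht : Summable fun k => ‖t k‖) (h : ∀ k, ‖s k‖ ≤ ‖t k‖) :
    ‖sparseSum s‖ ≤ ∑' S : Finset ℤ, ∏ k ∈ S, ‖t k‖ :=
  tsum_of_norm_bounded (summable_prod_norm ht).hasSum (norm_sparseTerm_le_of_le h)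

/-- Each finite set sees only finitely many coordinates, so its term is eventually constant; the
products of ‖t k‖ dominate. -/
theorem tendsto_sparseSum {ι : Type*} {l : Filter ι} {T : ι → ℤ → ℂ} {t s : ℤ → ℂ}
    (ht : Summable fun k => ‖t k‖) (hT : ∀ j k, ‖T j k‖ ≤ ‖t k‖)
    (hs : ∀ k, ∀ᶠ j in l, T j k = s k) :
    Tendsto (fun j => sparseSum (T j)) l (𝓝 (sparseSum s)) := by
  refine tendsto_tsum_of_dominated_convergence (summable_prod_norm ht) (fun S => ?_)
    (Eventually.of_forall fun j S => norm_sparseTerm_le_of_le (hT j) S)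
  refine tendsto_const_nhds.congr' ?_
  filter_upwards [(Filter.eventually_all_finset S).2 fun k _ => hs k] with j hj
  unfold sparseTerm
  split_ifs
  · exact Finset.prod_congr rfl fun k hk => by rw [hj k hk]
  · rfl

theorem sparseSum_zero : sparseSum 0 = 1 := by
  rw [sparseSum, tsum_eq_single ∅]
  · simp [sparseTerm, Sparse]
  · intro S hS
    obtain ⟨k, hk⟩ := Finset.nonempty_iff_ne_empty.2 hS
    unfold sparseTerm
    split_ifs
    · exact Finset.prod_eq_zero hk (by simp)
    · rfl

/-- Adding or removing `n`. -/
def toggle (n : ℤ) : Equiv.Perm (Finset ℤ) :=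
  Function.Involutive.toPerm (fun S => if n ∈ S then S.erase n else insert n S) fun S => by
    by_cases h : n ∈ S <;> simp [h]

theorem toggle_of_mem {n : ℤ} {S : Finset ℤ} (h : n ∈ S) : toggle n S = S.erase n := if_pos h

theorem toggle_of_notMem {n : ℤ} {S : Finset ℤ} (h : n ∉ S) : toggle n S = insert n S := if_neg h

theorem sparseTerm_eq_zero {t : ℤ → ℂ} {n : ℤ} {S : Finset ℤ} (h : n ∈ S) (ht : t n = 0) :
    sparseTerm t S = 0 := by
  unfold sparseTerm
  split_ifs
  · exact Finset.prod_eq_zero h (by simp [ht])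
  · rfl

theorem sparseTerm_congr {t s : ℤ → ℂ} {S : Finset ℤ} (h : ∀ k ∈ S, t k = s k) :
    sparseTerm t S = sparseTerm s S := by
  unfold sparseTerm
  rw [Finset.prod_congr rfl fun k hk => by rw [h k hk]]

/-- A set containing n is sparse exactly when it avoids n ± 1 and stays sparse without n. Since t₂
vanishes on [n-1, n+1], the toggled term is zero in all other cases. Using a permutation of all
finite sets makes the identity termwise, so it can be summed without splitting the index set. -/
theorem sparseTerm_split {t t₁ t₂ : ℤ → ℂ} {n : ℤ} (h1 : ∀ k, k ≠ n → t₁ k = t k) (h1n : t₁ n = 0)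
    (h2 : ∀ k, k < n - 1 ∨ n + 1 < k → t₂ k = t k)
    (h2n : ∀ k, n - 1 ≤ k → k ≤ n + 1 → t₂ k = 0) (S : Finset ℤ) :
    sparseTerm t S = sparseTerm t₁ S - t n * sparseTerm t₂ (toggle n S) := by
  by_cases hn : n ∈ S
  · rw [toggle_of_mem hn, sparseTerm_eq_zero hn h1n, zero_sub]
    by_cases hp : n + 1 ∈ S
    · rw [sparseTerm_eq_zero (t := t₂) (n := n + 1) (by simp [hp])
        (h2n _ (by omega) (by omega)), sparseTerm, if_neg fun h => h n hn hp]
      simp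
    by_cases hm : n - 1 ∈ S
    · rw [sparseTerm_eq_zero (t := t₂) (n := n - 1) (by simp [hm])
        (h2n _ (by omega) (by omega)), sparseTerm, if_neg fun h => h _ hm (by simpa using hn)]
      simp
    have hfar : ∀ k ∈ S.erase n, k < n - 1 ∨ n + 1 < k := by
      intro k hk
      obtain ⟨hk1, hk2⟩ := Finset.mem_erase.1 hk
      by_contra hcon
      have : k = n - 1 ∨ k = n + 1 := by omega
      rcases this with rfl | rfl
      · exact hm hk2
      · exact hp hk2
    rw [sparseTerm_congr (t := t₂) fun k hk => h2 k (hfar k hk)]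
    have hiff : Sparse S ↔ Sparse (S.erase n) := by
      constructor
      · intro h k hk hk'
        exact h k (Finset.mem_of_mem_erase hk) (Finset.mem_of_mem_erase hk')
      · intro h k hk hk'
        by_cases hkn : k = n
        · exact hp (hkn ▸ hk')
        · by_cases hkn' : k + 1 = n
          · exact hm (by rwa [← hkn', add_sub_cancel_right])
          · exact h k (Finset.mem_erase.2 ⟨hkn, hk⟩) (Finset.mem_erase.2 ⟨hkn', hk'⟩)
    unfold sparseTerm
    by_cases hS : Sparse S
    · rw [if_pos hS, if_pos (hiff.1 hS), ← Finset.mul_prod_erase S (fun k => -t k) hn, neg_mul]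
    · rw [if_neg hS, if_neg fun h => hS (hiff.2 h)]
      simp
  · rw [toggle_of_notMem hn, sparseTerm_eq_zero (t := t₂) (Finset.mem_insert_self n S)
      (h2n n (by omega) (by omega)),
      sparseTerm_congr (t := t) (s := t₁) fun k hk => (h1 k fun h => hn (h ▸ hk)).symm]
    simp

theorem hasSum_sparseTerm_toggle {t : ℤ → ℂ} (ht : Summable fun k => ‖t k‖) (n : ℤ) :
    HasSum (fun S => sparseTerm t (toggle n S)) (sparseSum t) := by
  generalize toggle n = e
  exact e.hasSum_iff.2 (summable_sparseTerm ht).hasSum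

theorem sparseSum_split {t t₁ t₂ : ℤ → ℂ} {n : ℤ} (ht : Summable fun k => ‖t k‖)
    (h1 : ∀ k, k ≠ n → t₁ k = t k) (h1n : t₁ n = 0)
    (h2 : ∀ k, k < n - 1 ∨ n + 1 < k → t₂ k = t k)
    (h2n : ∀ k, n - 1 ≤ k → k ≤ n + 1 → t₂ k = 0) :
    sparseSum t = sparseSum t₁ - t n * sparseSum t₂ := by
  have hs1 : Summable fun k => ‖t₁ k‖ := ht.of_nonneg_of_le (fun _ => norm_nonneg _) fun k => by
    by_cases hk : k = n
    · simp [hk, h1n]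
    · rw [h1 k hk]
  have hs2 : Summable fun k => ‖t₂ k‖ := ht.of_nonneg_of_le (fun _ => norm_nonneg _) fun k => by
    by_cases hk : k < n - 1 ∨ n + 1 < k
    · rw [h2 k hk]
    · rw [h2n k (by omega) (by omega)]; simp
  have hs2' := hasSum_sparseTerm_toggle hs2 n
  have hs := (summable_sparseTerm hs1).hasSum.sub (hs2'.mul_left (t n))
  rw [← funext (sparseTerm_split h1 h1n h2 h2n)] at hs
  exact hs.tsum_eq

/-! ### Truncated sums, their recurrences and the cut formula -/

/-- The sum over sparse sets in `[n, ∞)`. -/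
noncomputable def sumAbove (t : ℤ → ℂ) (n : ℤ) : ℂ := sparseSum fun k => if n ≤ k then t k else 0

/-- The sum over sparse sets in `(-∞, n]`. -/
noncomputable def sumBelow (t : ℤ → ℂ) (n : ℤ) : ℂ := sparseSum fun k => if k ≤ n then t k else 0

theorem summable_norm_ite {t : ℤ → ℂ} (ht : Summable fun k => ‖t k‖) (p : ℤ → Prop)
    [DecidablePred p] : Summable fun k => ‖if p k then t k else 0‖ :=
  ht.of_nonneg_of_le (fun _ => norm_nonneg _) fun k => by split_ifs <;> simp

theorem sumAbove_rec {t : ℤ → ℂ} (ht : Summable fun k => ‖t k‖) (n : ℤ) :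
    sumAbove t n = sumAbove t (n + 1) - t n * sumAbove t (n + 2) := by
  have := sparseSum_split (n := n) (t₁ := fun k => if n + 1 ≤ k then t k else 0)
    (t₂ := fun k => if n + 2 ≤ k then t k else 0) (summable_norm_ite ht fun k => n ≤ k)
    (fun k hk => ?_) (by simp) (fun k hk => ?_) (fun k _ hk => if_neg (by omega))
  · simp only [le_refl, if_true] at this
    exact this
  · exact if_congr (by omega) rfl rfl
  · exact if_congr (by omega) rfl rfl

theorem sumBelow_rec {t : ℤ → ℂ} (ht : Summable fun k => ‖t k‖) (n : ℤ) :
    sumBelow t n = sumBelow t (n - 1) - t n * sumBelow t (n - 2) := by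
  have := sparseSum_split (n := n) (t₁ := fun k => if k ≤ n - 1 then t k else 0)
    (t₂ := fun k => if k ≤ n - 2 then t k else 0) (summable_norm_ite ht fun k => k ≤ n)
    (fun k hk => ?_) (by simp) (fun k hk => ?_) (fun k hk _ => if_neg (by omega))
  · simp only [le_refl, if_true] at this
    exact this
  · exact if_congr (by omega) rfl rfl
  · exact if_congr (by omega) rfl rfl

theorem norm_sumAbove_le {t : ℤ → ℂ} (ht : Summable fun k => ‖t k‖) (n : ℤ) :
    ‖sumAbove t n‖ ≤ ∑' S : Finset ℤ, ∏ k ∈ S, ‖t k‖ :=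
  norm_sparseSum_le ht fun k => by split_ifs <;> simp

theorem norm_sumBelow_le {t : ℤ → ℂ} (ht : Summable fun k => ‖t k‖) (n : ℤ) :
    ‖sumBelow t n‖ ≤ ∑' S : Finset ℤ, ∏ k ∈ S, ‖t k‖ :=
  norm_sparseSum_le ht fun k => by split_ifs <;> simp

theorem tendsto_sumAbove {t : ℤ → ℂ} (ht : Summable fun k => ‖t k‖) :
    Tendsto (sumAbove t) atTop (𝓝 1) := by
  rw [← sparseSum_zero]
  refine tendsto_sparseSum ht (fun j k => by split_ifs <;> simp) fun k => ?_
  filter_upwards [eventually_gt_atTop k] with j hj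
  exact if_neg (by omega)

theorem tendsto_sumBelow {t : ℤ → ℂ} (ht : Summable fun k => ‖t k‖) :
    Tendsto (sumBelow t) atTop (𝓝 (sparseSum t)) := by
  refine tendsto_sparseSum ht (fun j k => by split_ifs <;> simp) fun k => ?_
  filter_upwards [eventually_ge_atTop k] with j hj
  exact if_pos hj

theorem eq_of_forall_succ_eq {W : ℤ → ℂ} (h : ∀ n, W (n + 1) = W n) (m n : ℤ) : W m = W n := by
  have h0 : ∀ n, W n = W 0 := fun n => by
    induction n using Int.induction_on with
    | zero => rfl
    | succ k ih => rw [h, ih]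
    | pred k ih => rw [← ih, ← h (-(k : ℤ) - 1), sub_add_cancel]
  rw [h0 m, h0 n]

theorem tendsto_atTop_zero_of_summable {t : ℤ → ℂ} (ht : Summable fun k => ‖t k‖) :
    Tendsto t atTop (𝓝 0) := by
  have := ht.of_norm.tendsto_cofinite_zero
  rw [Int.cofinite_eq] at this
  exact this.mono_left le_sup_right

/-- The sum over all sparse sets, cut at `n`. -/
theorem sparseSum_eq_wronskian {t : ℤ → ℂ} (ht : Summable fun k => ‖t k‖) (n : ℤ) :
    sumAbove t (n + 1) * sumBelow t (n - 1) - t n * sumAbove t (n + 2) * sumBelow t (n - 2) =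
      sparseSum t := by
  -- The two products collect the sparse sets avoiding n and those containing n. Instead of
  -- multiplying series, W is shown to be constant by the recurrences and evaluated as n → ∞.
  set W : ℤ → ℂ := fun n =>
    sumAbove t (n + 1) * sumBelow t (n - 1) - t n * sumAbove t (n + 2) * sumBelow t (n - 2) with hW
  have hrec : ∀ n, W (n + 1) = W n := fun n => by
    have h1 := sumAbove_rec ht (n + 1)
    have h2 := sumBelow_rec ht n
    simp only [hW]
    rw [show n + 1 + 2 = n + 3 by ring, show n + 1 + 1 = n + 2 by ring] at *
    rw [show n + 1 - 1 = n by ring, show n + 1 - 2 = n - 1 by ring]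
    linear_combination (-sumBelow t (n - 1)) * h1 + sumAbove t (n + 2) * h2
  have hlim : Tendsto W atTop (𝓝 (1 * sparseSum t - 0 * 1 * sparseSum t)) := by
    have ha : ∀ c : ℤ, Tendsto (fun n : ℤ => n + c) atTop atTop := fun c =>
      tendsto_atTop_add_const_right _ c tendsto_id
    exact (((tendsto_sumAbove ht).comp (ha 1)).mul ((tendsto_sumBelow ht).comp (ha (-1)))).sub
      (((tendsto_atTop_zero_of_summable ht).mul ((tendsto_sumAbove ht).comp (ha 2))).mul
        ((tendsto_sumBelow ht).comp (ha (-2))))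
  have hconst : W = fun _ => W n := funext fun m => eq_of_forall_succ_eq hrec m n
  rw [hconst] at hlim
  simpa using tendsto_nhds_unique tendsto_const_nhds hlim

/-- Absolute convergence allows grouping by cardinality m; the sign (-1)^m is absorbed into the
factors -t_k. -/
theorem frakF_eq_sparseSum {x : ℤ → ℂ} (hx : Summable fun k => ‖x k * x (k + 1)‖) :
    frakF x = sparseSum fun k => x k * x (k + 1) := by
  set t : ℤ → ℂ := fun k => x k * x (k + 1) with ht
  have hs := summable_sparseTerm hx
  let e : (Σ m : ℕ, {S : Finset ℤ // S.card = m}) ≃ Finset ℤ := Equiv.sigmaFiberEquiv Finset.card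
  have h1 : sparseSum t = ∑' m : ℕ, ∑' S : {S : Finset ℤ // S.card = m}, sparseTerm t S := by
    rw [sparseSum, ← e.tsum_eq]
    exact (e.summable_iff.2 hs).tsum_sigma
  rw [h1, frakF]
  refine tsum_congr fun m => ?_
  rw [← tsum_mul_left]
  let s : Set {S : Finset ℤ // S.card = m} := {S | Sparse S}
  have hsupp : Function.support (fun S : {S : Finset ℤ // S.card = m} => sparseTerm t S) ⊆ s := by
    intro S hS
    by_contra hcon
    exact hS (if_neg hcon)
  rw [← tsum_subtype_eq_of_support_subset hsupp]
  let e' : {S : Finset ℤ // S.card = m ∧ ∀ k ∈ S, k + 1 ∉ S} ≃ s :=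
    (Equiv.subtypeSubtypeEquivSubtypeInter (fun S : Finset ℤ => S.card = m) Sparse).symm
  rw [← e'.tsum_eq]
  refine tsum_congr fun S => ?_
  have : sparseTerm t S.1 = ∏ k ∈ S.1, -t k := if_pos S.2.2
  change _ = sparseTerm t S.1
  rw [this, Finset.prod_neg, S.2.1]

end DoublyInfiniteJacobi

namespace DoublyInfiniteJacobi

/-! ### Solutions of the difference equation -/

/-- `y` solves `𝒥 y = z y`. -/
def IsSol (lam w : ℤ → ℂ) (z : ℂ) (y : ℤ → ℂ) : Prop :=
  ∀ n, formalJacobi lam w y n = z * y n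

/-- The Wronskian `w_n (x_n y_{n+1} - x_{n+1} y_n)`. -/
def wronskian (w x y : ℤ → ℂ) (n : ℤ) : ℂ := w n * (x n * y (n + 1) - x (n + 1) * y n)

theorem formalJacobi_apply (lam w x : ℤ → ℂ) (n : ℤ) :
    formalJacobi lam w x n = w (n - 1) * x (n - 1) + lam n * x n + w n * x (n + 1) := rfl

theorem green_formula (lam w x y : ℤ → ℂ) (n : ℤ) :
    wronskian w x y n - wronskian w x y (n + 1) =
      formalJacobi lam w x (n + 1) * y (n + 1) - x (n + 1) * formalJacobi lam w y (n + 1) := by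
  simp only [formalJacobi_apply, wronskian, add_sub_cancel_right]
  ring

theorem wronskian_eq_of_isSol {lam w : ℤ → ℂ} {z : ℂ} {x y : ℤ → ℂ} (hx : IsSol lam w z x)
    (hy : IsSol lam w z y) (m n : ℤ) : wronskian w x y m = wronskian w x y n := by
  refine eq_of_forall_succ_eq (fun n => ?_) m n
  have := green_formula lam w x y n
  rw [hx, hy] at this
  linear_combination -this

/-- A Plücker relation: when f and h are independent, any sequence is recovered from its Wronskians
with them. -/
theorem wronskian_mul_apply (w f h u : ℤ → ℂ) (n : ℤ) :
    wronskian w f h n * u n = wronskian w u h n * f n - wronskian w u f n * h n := by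
  simp only [wronskian]; ring

theorem wronskian_swap (w x y : ℤ → ℂ) (n : ℤ) : wronskian w x y n = -wronskian w y x n := by
  simp only [wronskian]; ring

theorem IsSol.eq_zero {lam w : ℤ → ℂ} {z : ℂ} {u : ℤ → ℂ} (hw : ∀ n, w n ≠ 0)
    (hu : IsSol lam w z u) (h0 : u 0 = 0) (h1 : u 1 = 0) : u = 0 := by
  have key : ∀ n : ℤ, u n = 0 ∧ u (n + 1) = 0 := fun n => by
    induction n using Int.induction_on with
    | zero => exact ⟨h0, by simpa using h1⟩
    | succ k ih =>
      refine ⟨ih.2, ?_⟩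
      have := hu (k + 1)
      rw [formalJacobi_apply, add_sub_cancel_right, ih.1, ih.2] at this
      simpa [hw] using this
    | pred k ih =>
      rw [sub_add_cancel]
      refine ⟨?_, ih.1⟩
      have := hu (-(k : ℤ))
      rw [formalJacobi_apply, ih.1, ih.2] at this
      simpa [hw] using this
  exact funext fun n => (key n).1

/-- A backward Grönwall argument: weighting X n by the exponential of the partial sums of b makes it
nondecreasing, and the weighted sequence still tends to 0. -/
theorem eq_zero_of_le_mul_one_add {X b : ℕ → ℝ} (hX : ∀ n, 0 ≤ X n)
    (hbs : Summable b) (hle : ∀ n, X n ≤ X (n + 1) * (1 + b n)) (hlim : Tendsto X atTop (𝓝 0))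
    (n : ℕ) : X n = 0 := by
  set Y : ℕ → ℝ := fun n => X n * Real.exp (∑ k ∈ Finset.range n, b k) with hY
  have hmono : Monotone Y := monotone_nat_of_le_succ fun n => by
    simp only [hY]
    rw [Finset.sum_range_succ, Real.exp_add, mul_comm (Real.exp _), ← mul_assoc]
    refine mul_le_mul_of_nonneg_right ((hle n).trans ?_) (Real.exp_pos _).le
    refine mul_le_mul_of_nonneg_left ?_ (hX _)
    linarith [Real.add_one_le_exp (b n)]
  have hYlim : Tendsto Y atTop (𝓝 (0 * Real.exp (∑' k, b k))) :=
    hlim.mul ((Real.continuous_exp.tendsto _).comp hbs.hasSum.tendsto_sum_nat)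
  have h0 : Y n ≤ 0 := by simpa using hmono.ge_of_tendsto hYlim n
  exact le_antisymm (nonpos_of_mul_nonpos_left h0 (Real.exp_pos _)) (hX n)

/-- Variation of constants near +∞: u is controlled by its Wronskians with f and h, and by Green's
formula each Wronskian changes in one step by (z-z') times a product of values. The total size X of
the two Wronskians then satisfies the backward Grönwall inequality. -/
theorem IsSol.eq_zero_of_tendsto_atTop {lam w : ℤ → ℂ} {z z' : ℂ} {u f h : ℤ → ℂ}
    (hw : ∀ n, w n ≠ 0) (hu : IsSol lam w z u) (hf : IsSol lam w z' f) (hh : IsSol lam w z' h)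
    (hc : wronskian w f h 0 ≠ 0) (hfs : Summable fun k : ℕ => ‖f k‖ ^ 2)
    (hhs : Summable fun k : ℕ => ‖h k‖ ^ 2) (huf : Tendsto (wronskian w u f) atTop (𝓝 0))
    (huh : Tendsto (wronskian w u h) atTop (𝓝 0)) : u = 0 := by
  set c := wronskian w f h 0
  have hcpos : 0 < ‖c‖ := norm_pos_iff.2 hc
  set X : ℕ → ℝ := fun n => ‖wronskian w u h n‖ + ‖wronskian w u f n‖ with hX
  have hbound : ∀ n : ℕ, ‖c‖ * ‖u n‖ ≤ X n * (‖f n‖ + ‖h n‖) := fun n => by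
    rw [← norm_mul, show c * u n = _ from
      (wronskian_eq_of_isSol hf hh 0 n) ▸ wronskian_mul_apply w f h u n]
    refine (norm_sub_le _ _).trans ?_
    rw [norm_mul, norm_mul]
    simp only [hX]
    nlinarith [norm_nonneg (wronskian w u h n), norm_nonneg (wronskian w u f n),
      norm_nonneg (f n), norm_nonneg (h n)]
  have hstep : ∀ (y : ℤ → ℂ), IsSol lam w z' y → ∀ n : ℕ, ‖wronskian w u y n‖ ≤
      ‖wronskian w u y (n + 1 : ℕ)‖ + ‖z - z'‖ * (‖u (n + 1 : ℕ)‖ * ‖y (n + 1 : ℕ)‖) := by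
    intro y hy n
    have h1 := green_formula lam w u y n
    rw [hu, hy] at h1
    have h2 : wronskian w u y n = wronskian w u y ((n + 1 : ℕ) : ℤ) +
        (z - z') * (u (n + 1 : ℕ) * y (n + 1 : ℕ)) := by
      push_cast
      linear_combination h1
    rw [h2, ← norm_mul, ← norm_mul]
    exact norm_add_le _ _
  set κ := ‖z - z'‖ / ‖c‖
  have hκ : 0 ≤ κ := by positivity
  have hX0 : ∀ n, X n = 0 := by
    -- The factor 2 comes from (F+G)² ≤ 2(F²+G²).
    refine eq_zero_of_le_mul_one_add
      (b := fun n => 2 * κ * (‖f (n + 1 : ℕ)‖ ^ 2 + ‖h (n + 1 : ℕ)‖ ^ 2))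
      (fun n => by positivity)
      ((((summable_nat_add_iff 1).2 hfs).add ((summable_nat_add_iff 1).2 hhs)).mul_left _)
      (fun n => ?_) ?_
    · have h1 := hstep f hf n
      have h2 := hstep h hh n
      have h3 : ‖u (n + 1 : ℕ)‖ ≤ X (n + 1) * (‖f (n + 1 : ℕ)‖ + ‖h (n + 1 : ℕ)‖) / ‖c‖ := by
        rw [le_div_iff₀ hcpos, mul_comm]
        exact hbound (n + 1)
      set F := ‖f (n + 1 : ℕ)‖
      set G := ‖h (n + 1 : ℕ)‖
      have hF : 0 ≤ F := norm_nonneg _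
      have hG : 0 ≤ G := norm_nonneg _
      have hXn : 0 ≤ X (n + 1) := by positivity
      calc X n ≤ X (n + 1) + ‖z - z'‖ * (‖u (n + 1 : ℕ)‖ * (F + G)) := by
            simp only [hX]; linarith
        _ ≤ X (n + 1) + ‖z - z'‖ * (X (n + 1) * (F + G) / ‖c‖ * (F + G)) := by gcongr
        _ = X (n + 1) * (1 + κ * (F + G) ^ 2) := by simp only [κ]; ring
        _ ≤ X (n + 1) * (1 + 2 * κ * (F ^ 2 + G ^ 2)) := by
            refine mul_le_mul_of_nonneg_left ?_ hXn
            nlinarith [mul_nonneg hκ (sq_nonneg (F - G))]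
    · have := ((huh.norm).add (huf.norm)).comp (tendsto_natCast_atTop_atTop (R := ℤ))
      rw [norm_zero, add_zero] at this
      exact this
  have hu0 : ∀ n : ℕ, u n = 0 := fun n => by
    have := hbound n
    rw [hX0, zero_mul] at this
    exact norm_le_zero_iff.1 (nonpos_of_mul_nonpos_right this hcpos)
  exact hu.eq_zero hw (by simpa using hu0 0) (by simpa using hu0 1)

/-- Reflection n ↦ -n exchanges the two ends. Since w n links the sites n and n+1, its reflected
index is -n-1. -/
theorem formalJacobi_reflect (lam w x : ℤ → ℂ) (n : ℤ) :
    formalJacobi (fun n => lam (-n)) (fun n => w (-n - 1)) (fun n => x (-n)) n =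
      formalJacobi lam w x (-n) := by
  simp only [formalJacobi_apply]
  rw [show -(n - 1) - 1 = -n by ring, show -(n - 1) = -n + 1 by ring,
    show -(n + 1) = -n - 1 by ring]
  ring

theorem wronskian_reflect (w x y : ℤ → ℂ) (n : ℤ) :
    wronskian (fun n => w (-n - 1)) (fun n => x (-n)) (fun n => y (-n)) n =
      -wronskian w x y (-n - 1) := by
  simp only [wronskian]
  rw [show -(n + 1) = -n - 1 by ring, show -n - 1 + 1 = -n by ring]
  ring

theorem IsSol.eq_zero_of_tendsto_atBot {lam w : ℤ → ℂ} {z z' : ℂ} {u f h : ℤ → ℂ}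
    (hw : ∀ n, w n ≠ 0) (hu : IsSol lam w z u) (hf : IsSol lam w z' f) (hh : IsSol lam w z' h)
    (hc : wronskian w f h 0 ≠ 0) (hfs : Summable fun k : ℕ => ‖f (-k)‖ ^ 2)
    (hhs : Summable fun k : ℕ => ‖h (-k)‖ ^ 2) (huf : Tendsto (wronskian w u f) atBot (𝓝 0))
    (huh : Tendsto (wronskian w u h) atBot (𝓝 0)) : u = 0 := by
  have hsol : ∀ {z : ℂ} {y : ℤ → ℂ}, IsSol lam w z y →
      IsSol (fun n => lam (-n)) (fun n => w (-n - 1)) z fun n => y (-n) := fun hy n => by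
    rw [formalJacobi_reflect, hy]
  have hlim : ∀ {y : ℤ → ℂ}, Tendsto (wronskian w u y) atBot (𝓝 0) →
      Tendsto (wronskian (fun n => w (-n - 1)) (fun n => u (-n)) fun n => y (-n)) atTop (𝓝 0) := by
    intro y hy
    rw [funext (wronskian_reflect w u y)]
    have : Tendsto (fun n : ℤ => -n - 1) atTop atBot :=
      tendsto_atBot_add_const_right _ (-1) tendsto_neg_atTop_atBot
    simpa using (hy.comp this).neg
  have := IsSol.eq_zero_of_tendsto_atTop (fun n => hw _) (hsol hu) (hsol hf) (hsol hh)
    (by rw [wronskian_reflect, wronskian_eq_of_isSol hf hh _ 0]; exact neg_ne_zero.2 hc)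
    hfs hhs (hlim huf) (hlim huh)
  funext n
  simpa using congrFun this (-n)

/-! ### The two decaying solutions -/

theorem exists_forall_succ_eq_mul {r : ℤ → ℂ} (hr : ∀ n, r n ≠ 0) :
    ∃ P : ℤ → ℂ, (∀ n, P n ≠ 0) ∧ ∀ n, P (n + 1) = r n * P n := by
  refine ⟨fun n => match n with
    | Int.ofNat k => ∏ i ∈ Finset.range k, r i
    | Int.negSucc k => (∏ i ∈ Finset.range (k + 1), r (Int.negSucc i))⁻¹, ?_, ?_⟩
  · rintro (k | k)
    · exact Finset.prod_ne_zero_iff.2 fun _ _ => hr _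
    · exact inv_ne_zero (Finset.prod_ne_zero_iff.2 fun _ _ => hr _)
  · rintro (k | k)
    · change ∏ i ∈ Finset.range (k + 1), r i = _
      rw [Finset.prod_range_succ, mul_comm]
      rfl
    · rcases k with - | k
      · change ∏ i ∈ Finset.range 0, r i = _
        simp [hr]
      · change (∏ i ∈ Finset.range (k + 1), r (Int.negSucc i))⁻¹ =
          r (Int.negSucc (k + 1)) * (∏ i ∈ Finset.range (k + 1 + 1), r (Int.negSucc i))⁻¹
        rw [Finset.prod_range_succ _ (k + 1), mul_inv, mul_comm, mul_assoc, inv_mul_cancel₀ (hr _),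
          mul_one]

theorem sum_range_norm_le {t : ℤ → ℂ} (ht : Summable fun k => ‖t k‖) (m : ℤ) (d : ℕ) :
    ∑ i ∈ Finset.range d, ‖t (m + i)‖ ≤ ∑' k, ‖t k‖ := by
  have hinj : Function.Injective fun i : ℕ => m + (i : ℤ) := fun i j h => by simpa using h
  rw [← Finset.sum_image (s := Finset.range d) (g := fun i : ℕ => m + (i : ℤ))
    (f := fun k => ‖t k‖) fun i _ j _ h => hinj h]
  exact ht.sum_le_tsum _ fun _ _ => norm_nonneg _

/-- `w_n² / ((z - λ_n) (z - λ_{n+1}))`. -/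
noncomputable def edge (lam w : ℤ → ℂ) (z : ℂ) (n : ℤ) : ℂ :=
  w n ^ 2 / ((z - lam n) * (z - lam (n + 1)))

/-- Summability makes t small, so any geometric rate is available at the cost of a constant: x ≤
(1/4)·exp(4x) for every factor x = ‖t‖. The rate 1/4 becomes 1/2 after a square root. -/
theorem le_mul_pow_of_succ_eq {t : ℤ → ℂ} (ht : Summable fun k => ‖t k‖) {a : ℤ → ℝ}
    (ha : ∀ n, 0 ≤ a n) (hrec : ∀ n, a (n + 1) = ‖t n‖ * a n) (m : ℤ) (d : ℕ) :
    a (m + d) ≤ a m * ((1 / 4) ^ d * Real.exp (4 * ∑' k, ‖t k‖)) := by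
  have h1 : a (m + d) ≤
      a m * ((1 / 4) ^ d * Real.exp (4 * ∑ i ∈ Finset.range d, ‖t (m + i)‖)) := by
    induction d with
    | zero => simp
    | succ d ih =>
      rw [Finset.sum_range_succ, mul_add, Real.exp_add, pow_succ]
      push_cast
      rw [← add_assoc, hrec]
      have h4 : ‖t (m + d)‖ ≤ 1 / 4 * Real.exp (4 * ‖t (m + d)‖) := by
        linarith [Real.add_one_le_exp (4 * ‖t (m + d)‖)]
      calc ‖t (m + d)‖ * a (m + d) ≤ 1 / 4 * Real.exp (4 * ‖t (m + d)‖) *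
            (a m * ((1 / 4) ^ d * Real.exp (4 * ∑ i ∈ Finset.range d, ‖t (m + i)‖))) :=
            mul_le_mul h4 ih (ha _) (by positivity)
        _ = _ := by ring
  refine h1.trans ?_
  have := sum_range_norm_le ht m d
  have := ha m
  gcongr

/-- P and Q are the leading factors of the solutions at +∞ and -∞, obtained by dropping one
neighbour term of the recurrence; Q_n = 1/(P_n(z-λ_n)) normalizes their Wronskian. -/
theorem exists_decaying_weights {lam w : ℤ → ℂ} {z : ℂ} {δ : ℝ} (hw : ∀ n, w n ≠ 0)
    (hδ : 0 < δ) (hz : ∀ n, δ ≤ ‖z - lam n‖) (ht : Summable fun n => ‖edge lam w z n‖) :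
    ∃ (P Q : ℤ → ℂ) (C : ℝ), (∀ n, P n ≠ 0) ∧ (∀ n, Q n ≠ 0) ∧
      (∀ n, w n * P n = (z - lam (n + 1)) * P (n + 1)) ∧
      (∀ n, w n * Q (n + 1) = (z - lam n) * Q n) ∧
      (∀ n, w n * (P n * Q (n + 1)) = 1) ∧
      (∀ n, w n * (P (n + 1) * Q n) = edge lam w z n) ∧
      ∀ (m : ℤ) (d : ℕ), ‖Q m * P (m + d)‖ ≤ C * (1 / 2) ^ d := by
  have hz0 : ∀ n, z - lam n ≠ 0 := fun n => norm_pos_iff.1 (hδ.trans_le (hz n))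
  obtain ⟨P, hP, hrec⟩ := exists_forall_succ_eq_mul (r := fun n => w n / (z - lam (n + 1)))
    fun n => div_ne_zero (hw n) (hz0 _)
  refine ⟨P, fun n => (P n * (z - lam n))⁻¹, Real.exp (2 * ∑' n, ‖edge lam w z n‖) / δ, hP,
    fun n => inv_ne_zero (mul_ne_zero (hP n) (hz0 n)), fun n => ?_, fun n => ?_, fun n => ?_,
    fun n => ?_, fun m d => ?_⟩
  · rw [hrec]; field_simp [hz0 (n + 1)]
  · beta_reduce
    rw [hrec]; field_simp [hz0 (n + 1), hz0 n, hP n, hw n]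
  · beta_reduce
    rw [hrec]; field_simp [hz0 (n + 1), hz0 n, hP n, hw n]
  · rw [hrec, edge]; field_simp [hz0 (n + 1), hz0 n, hP n, hw n]
  -- The quantity ‖P n‖²‖z - λ n‖ is multiplied by exactly ‖t n‖ at each step. Passing back to ‖Q m
  -- · P (m+d)‖ uses ‖z - λ‖ ≥ δ at both sites, hence the division by δ.
  · have ha := le_mul_pow_of_succ_eq ht (a := fun n => ‖P n‖ ^ 2 * ‖z - lam n‖)
      (fun n => by positivity) (fun n => by
        have h0 := norm_pos_iff.2 (hz0 n)
        have h1 := norm_pos_iff.2 (hz0 (n + 1))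
        simp only [hrec, edge, norm_mul, norm_div, norm_pow]
        field_simp) m d
    have hPm := norm_pos_iff.2 (hP m)
    have hzm := norm_pos_iff.2 (hz0 m)
    have hzd := norm_pos_iff.2 (hz0 (m + d))
    refine (pow_le_pow_iff_left₀ (norm_nonneg _) (by positivity) two_ne_zero).1 ?_
    have e1 : (Real.exp (2 * ∑' n, ‖edge lam w z n‖) / δ * (1 / 2) ^ d) ^ 2 =
        (1 / 4) ^ d * Real.exp (4 * ∑' n, ‖edge lam w z n‖) / δ ^ 2 := by
      rw [mul_pow, div_pow, ← Real.exp_nat_mul, ← pow_mul, mul_comm d 2, pow_mul]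
      norm_num
      ring_nf
    rw [e1, norm_mul, norm_inv, norm_mul, le_div_iff₀ (by positivity)]
    calc ((‖P m‖ * ‖z - lam m‖)⁻¹ * ‖P (m + d)‖) ^ 2 * δ ^ 2
        ≤ ((‖P m‖ * ‖z - lam m‖)⁻¹ * ‖P (m + d)‖) ^ 2 * (‖z - lam m‖ * ‖z - lam (m + d)‖) := by
          rw [sq δ]
          exact mul_le_mul_of_nonneg_left
            (mul_le_mul (hz m) (hz (m + d)) hδ.le (norm_nonneg _)) (by positivity)
      _ = ‖P (m + d)‖ ^ 2 * ‖z - lam (m + d)‖ / (‖P m‖ ^ 2 * ‖z - lam m‖) := by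
          field_simp
      _ ≤ _ := by
          rw [div_le_iff₀ (by positivity)]
          linarith

/-- Solutions decaying at `∞` and `-∞`, with their Wronskian. -/
theorem exists_weyl_solutions {lam w : ℤ → ℂ} {z : ℂ} {δ : ℝ} (hw : ∀ n, w n ≠ 0)
    (hδ : 0 < δ) (hz : ∀ n, δ ≤ ‖z - lam n‖) (ht : Summable fun n => ‖edge lam w z n‖) :
    ∃ (f g : ℤ → ℂ) (C : ℝ), IsSol lam w z f ∧ IsSol lam w z g ∧
      (∀ n, wronskian w f g n = sparseSum (edge lam w z)) ∧
      (∀ (m : ℤ) (d : ℕ), ‖g m * f (m + d)‖ ≤ C * (1 / 2) ^ d) ∧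
      (∀ d : ℕ, ‖f d‖ ≤ C * (1 / 2) ^ d) ∧ ∀ d : ℕ, ‖g (-d)‖ ≤ C * (1 / 2) ^ d := by
  obtain ⟨P, Q, C, hP, hQ, hPrec, hQrec, hPQ, hPQ', hdecay⟩ := exists_decaying_weights hw hδ hz ht
  set t := edge lam w z
  set M := ∑' S : Finset ℤ, ∏ k ∈ S, ‖t k‖
  have hA := norm_sumAbove_le ht
  have hB := norm_sumBelow_le ht
  have hM : 0 ≤ M := (norm_nonneg _).trans (hA 0)
  have hC : 0 ≤ C := (norm_nonneg (Q 0 * P 0)).trans (by simpa using hdecay 0 0)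
  -- Only edges between sites strictly beyond n enter: the edge k joins k and k+1, hence the cut at
  -- n+1 for f and at n-2 for g. The last two constants come from dividing the product bound by Q 0
  -- and by P 0.
  refine ⟨fun n => P n * sumAbove t (n + 1), fun n => Q n * sumBelow t (n - 2),
    max (C * M * M) (max (C * M * ‖Q 0‖⁻¹) (C * M * ‖P 0‖⁻¹)), fun n => ?_, fun n => ?_,
    fun n => ?_, fun m d => ?_, fun d => ?_, fun d => ?_⟩
  · have h1 := sumAbove_rec ht n
    have h2 := hPrec (n - 1)
    have h3 : w n * P (n + 1) = (z - lam n) * P n * t n := by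
      have h4 := hPQ' n
      have h5 := hPQ n
      have h6 := hQrec n
      have : w n * Q (n + 1) ≠ 0 := mul_ne_zero (hw n) (hQ _)
      refine mul_right_cancel₀ this ?_
      linear_combination ((z - lam n)) * h4 + w n * P (n + 1) * h6 - (z - lam n) * t n * h5
    rw [sub_add_cancel] at h2
    rw [formalJacobi_apply, sub_add_cancel, show n + 1 + 1 = n + 2 by ring]
    linear_combination h2 * sumAbove t n + (z - lam n) * P n * h1 + sumAbove t (n + 2) * h3
  · have h1 := sumBelow_rec ht (n - 1)
    have h2 := hQrec n
    have h3 : w (n - 1) * Q (n - 1) = (z - lam n) * Q n * t (n - 1) := by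
      have h4 := hPQ' (n - 1)
      have h5 := hPQ (n - 1)
      have h6 := hPrec (n - 1)
      rw [sub_add_cancel] at h4 h5 h6
      have : w (n - 1) * P (n - 1) ≠ 0 := mul_ne_zero (hw _) (hP _)
      refine mul_right_cancel₀ this ?_
      linear_combination ((z - lam n)) * h4 + w (n - 1) * Q (n - 1) * h6
        - (z - lam n) * t (n - 1) * h5
    rw [show n - 1 - 1 = n - 2 by ring, show n - 1 - 2 = n - 3 by ring] at h1
    rw [formalJacobi_apply, show n - 1 - 2 = n - 3 by ring, show n + 1 - 2 = n - 1 by ring]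
    linear_combination h2 * sumBelow t (n - 1) + (z - lam n) * Q n * h1 + sumBelow t (n - 3) * h3
  · rw [← sparseSum_eq_wronskian ht n, wronskian, show n + 1 + 1 = n + 2 by ring,
      show n + 1 - 2 = n - 1 by ring]
    linear_combination hPQ n * (sumAbove t (n + 1) * sumBelow t (n - 1))
      - hPQ' n * (sumAbove t (n + 2) * sumBelow t (n - 2))
  · calc ‖Q m * sumBelow t (m - 2) * (P (m + d) * sumAbove t (m + d + 1))‖
        = ‖Q m * P (m + d)‖ * ‖sumBelow t (m - 2)‖ * ‖sumAbove t (m + d + 1)‖ := by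
          simp only [norm_mul]; ring
      _ ≤ C * (1 / 2) ^ d * M * M := by
          have := hdecay m d
          gcongr
          exacts [hB _, hA _]
      _ = C * M * M * (1 / 2) ^ d := by ring
      _ ≤ _ := by gcongr; exact le_max_left _ _
  · have hQ0 := norm_pos_iff.2 (hQ 0)
    calc ‖P d * sumAbove t (d + 1)‖ = ‖Q 0 * P (0 + d)‖ * ‖sumAbove t (d + 1)‖ * ‖Q 0‖⁻¹ := by
          simp only [norm_mul, zero_add]; field_simp
      _ ≤ C * (1 / 2) ^ d * M * ‖Q 0‖⁻¹ := by
          have := hdecay 0 d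
          gcongr
          exact hA _
      _ = C * M * ‖Q 0‖⁻¹ * (1 / 2) ^ d := by ring
      _ ≤ _ := by gcongr; exact (le_max_left _ _).trans (le_max_right _ _)
  · have hP0 := norm_pos_iff.2 (hP 0)
    calc ‖Q (-d) * sumBelow t (-d - 2)‖
        = ‖Q (-d) * P (-d + d)‖ * ‖sumBelow t (-d - 2)‖ * ‖P 0‖⁻¹ := by
          simp only [norm_mul, neg_add_cancel]; field_simp
      _ ≤ C * (1 / 2) ^ d * M * ‖P 0‖⁻¹ := by
          have := hdecay (-d) d
          gcongr
          exact hB _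
      _ = C * M * ‖P 0‖⁻¹ * (1 / 2) ^ d := by ring
      _ ≤ _ := by gcongr; exact (le_max_right _ _).trans (le_max_right _ _)

end DoublyInfiniteJacobi

namespace DoublyInfiniteJacobi

/-! ### The space `ℓ²(ℤ)` and its bilinear pairing -/

/-- The standard basis vector `e_n`. -/
noncomputable def basisVec (n : ℤ) : EllTwo := lp.single 2 n (1 : ℂ)

theorem basisVec_apply (n k : ℤ) : basisVec n k = if k = n then 1 else 0 := by
  rw [basisVec, lp.single_apply, Pi.single_apply]

/-- The `n`-th coordinate. -/
noncomputable def coord (n : ℤ) : EllTwo →L[ℂ] ℂ := lp.evalCLM ℂ (fun _ : ℤ => ℂ) 2 n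

@[simp] theorem coord_apply (n : ℤ) (x : EllTwo) : coord n x = x n := rfl

theorem clm_ext {V : Type*} [NormedAddCommGroup V] [NormedSpace ℂ V] {A B : EllTwo →L[ℂ] V}
    (h : ∀ n, A (basisVec n) = B (basisVec n)) : A = B := by
  refine lp.ext_continuousLinearMap (by simp) fun n => ContinuousLinearMap.ext_ring ?_
  exact h n

theorem summable_norm_sq (x : EllTwo) : Summable fun n => ‖x n‖ ^ 2 := by
  simpa using (lp.memℓp x).summable (by simp)

theorem memℓp_two {x : ℤ → ℂ} (hx : Summable fun n => ‖x n‖ ^ 2) : Memℓp x 2 :=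
  memℓp_gen (by simpa using hx)

theorem exists_ellTwo {x : ℤ → ℂ} (hx : Summable fun n => ‖x n‖ ^ 2) :
    ∃ X : EllTwo, ∀ n, X n = x n := ⟨⟨x, memℓp_two hx⟩, fun _ => rfl⟩

/-- `y ↦ ∑ x_n y_n`. -/
noncomputable def pairing (x : EllTwo) : EllTwo →L[ℂ] ℂ := innerSL ℂ (star x)

theorem pairing_eq_inner (x y : EllTwo) : pairing x y = inner ℂ (star x) y := rfl

theorem hasSum_pairing (x y : EllTwo) : HasSum (fun n => x n * y n) (pairing x y) := by
  have h := lp.hasSum_inner (𝕜 := ℂ) (star x) y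
  have h' : (fun n => inner ℂ ((star x : EllTwo) n) (y n)) = fun n => x n * y n := by
    funext n
    simp [mul_comm]
  rwa [h'] at h

theorem pairing_apply (x y : EllTwo) : pairing x y = ∑' n, x n * y n :=
  (hasSum_pairing x y).tsum_eq.symm

theorem pairing_comm (x y : EllTwo) : pairing x y = pairing y x := by
  simp only [pairing_apply, mul_comm]

theorem pairing_basisVec (x : EllTwo) (n : ℤ) : pairing x (basisVec n) = x n := by
  rw [pairing_apply, tsum_eq_single n fun k hk => by simp [basisVec_apply, hk]]
  simp [basisVec_apply]

theorem summable_norm_mul (x y : EllTwo) : Summable fun n => ‖x n‖ * ‖y n‖ := by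
  refine Summable.of_nonneg_of_le (fun n => by positivity) (fun n => ?_)
    ((summable_norm_sq x).add (summable_norm_sq y))
  nlinarith [sq_nonneg (‖x n‖ - ‖y n‖), sq_nonneg (‖x n‖ + ‖y n‖)]

/-- The diagonal operator with bounded entries composed with a shift. -/
theorem exists_weighted_shift {c : ℤ → ℂ} {b : ℝ} (hc : ∀ n, ‖c n‖ ≤ b) (d : ℤ) :
    ∃ T : EllTwo →L[ℂ] EllTwo, ‖T‖ ≤ b ∧ ∀ x n, T x n = c n * x (n + d) := by
  have hb : 0 ≤ b := (norm_nonneg _).trans (hc 0)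
  have hshift : ∀ x : EllTwo, HasSum (fun n => b ^ 2 * ‖x (n + d)‖ ^ 2) (b ^ 2 * ‖x‖ ^ 2) := by
    intro x
    have h := lp.hasSum_norm (p := 2) (by simp) x
    simp only [ENNReal.toReal_ofNat, Real.rpow_ofNat] at h
    exact ((Equiv.addRight d).hasSum_iff.2 h).mul_left _
  have hle : ∀ (x : EllTwo) n, ‖c n * x (n + d)‖ ^ 2 ≤ b ^ 2 * ‖x (n + d)‖ ^ 2 := fun x n => by
    rw [norm_mul, mul_pow]
    have := hc n
    gcongr
  have hmem : ∀ x : EllTwo, Summable fun n => ‖c n * x (n + d)‖ ^ 2 := fun x =>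
    Summable.of_nonneg_of_le (fun n => by positivity) (hle x) (hshift x).summable
  let L : EllTwo →ₗ[ℂ] EllTwo :=
    { toFun := fun x => ⟨fun n => c n * x (n + d), memℓp_two (hmem x)⟩
      map_add' := fun x y => Subtype.ext (funext fun n => by
        change c n * (x (n + d) + y (n + d)) = c n * x (n + d) + c n * y (n + d); ring)
      map_smul' := fun a x => Subtype.ext (funext fun n => by
        change c n * (a * x (n + d)) = a * (c n * x (n + d)); ring) }
  refine ⟨L.mkContinuous b fun x => ?_, L.mkContinuous_norm_le hb _, fun x n => rfl⟩
  refine lp.norm_le_of_tsum_le (by simp) (by positivity) ?_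
  simp only [ENNReal.toReal_ofNat, Real.rpow_ofNat, mul_pow]
  exact hasSum_le (hle x) (hmem x).hasSum (hshift x)

theorem summable_half_pow_natAbs : Summable fun d : ℤ => (1 / 2 : ℝ) ^ d.natAbs := by
  refine Summable.of_nat_of_neg ?_ ?_ <;> simpa using summable_geometric_two

/-- The d-th diagonal of the kernel is a weighted shift of norm at most C·2^{-|d|}, so the sum over
d converges in operator norm. -/
theorem exists_kernel_operator {G : ℤ → ℤ → ℂ} {C : ℝ}
    (hG : ∀ m n, ‖G m n‖ ≤ C * (1 / 2) ^ (n - m).natAbs) :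
    ∃ R : EllTwo →L[ℂ] EllTwo, ∀ m n, R (basisVec n) m = G m n := by
  have h : ∀ d : ℤ, ∃ T : EllTwo →L[ℂ] EllTwo, ‖T‖ ≤ C * (1 / 2) ^ d.natAbs ∧
      ∀ x m, T x m = G m (m + d) * x (m + d) := fun d =>
    exists_weighted_shift (fun m => by simpa using hG m (m + d)) d
  choose T hT hTx using h
  have hsum : Summable T := Summable.of_norm_bounded (summable_half_pow_natAbs.mul_left C) hT
  refine ⟨∑' d, T d, fun m n => ?_⟩
  have h1 : HasSum (fun d => T d (basisVec n) m) ((∑' d, T d) (basisVec n) m) := by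
    have := (hsum.hasSum.mapL (ContinuousLinearMap.apply ℂ EllTwo (basisVec n))).mapL (coord m)
    exact this
  rw [← h1.tsum_eq, tsum_eq_single (n - m)]
  · simp [hTx, basisVec_apply]
  · intro d hd
    rw [hTx, basisVec_apply, if_neg (by omega), mul_zero]

/-! ### Graphs of the minimal and the maximal operator -/

variable {lam w : ℤ → ℂ}

/-- `𝒥 e_n`. -/
noncomputable def jacobiBasisVec (lam w : ℤ → ℂ) (n : ℤ) : EllTwo :=
  w (n - 1) • basisVec (n - 1) + lam n • basisVec n + w n • basisVec (n + 1)

theorem jacobiBasisVec_apply (n k : ℤ) :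
    jacobiBasisVec lam w n k = formalJacobi lam w (basisVec n) k := by
  change w (n - 1) * basisVec (n - 1) k + lam n * basisVec n k + w n * basisVec (n + 1) k = _
  simp only [formalJacobi_apply, basisVec_apply]
  rcases eq_or_ne k (n - 1) with rfl | h1
  · rw [if_pos rfl, if_neg (by omega), if_neg (by omega), if_neg (by omega), if_pos (by omega)]
    simp
  rcases eq_or_ne k n with rfl | h2
  · rw [if_neg h1, if_pos rfl, if_neg (by omega), if_neg (by omega), if_neg (by omega)]
  rcases eq_or_ne k (n + 1) with rfl | h3
  · rw [if_neg h1, if_neg h2, if_pos rfl, if_pos (by omega), if_neg (by omega)]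
    simp
  rw [if_neg h1, if_neg h2, if_neg h3, if_neg (by omega), if_neg (by omega)]
  simp

theorem mem_graph_jacobiMax {x y : EllTwo} :
    (x, y) ∈ (jacobiMax lam w).graph ↔ ∀ n, formalJacobi lam w x n = y n := by
  rw [LinearPMap.mem_graph_iff]
  constructor
  · rintro ⟨a, rfl, rfl⟩ n
    rfl
  · intro h
    have h' : formalJacobi lam w x = y := funext h
    refine ⟨⟨x, ?_⟩, rfl, Subtype.ext h'⟩
    change Memℓp (formalJacobi lam w x) 2
    rw [h']
    exact lp.memℓp y

theorem mem_graph_jacobiZero (n : ℤ) :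
    (basisVec n, jacobiBasisVec lam w n) ∈ (jacobiZero lam w).graph := by
  have hn : basisVec n ∈ finiteSpan := Submodule.subset_span ⟨n, rfl⟩
  have hmem : basisVec n ∈ (jacobiZero lam w).domain := ⟨hn, finiteSpan_le_domain lam w hn⟩
  refine (LinearPMap.mem_graph_iff _).2 ⟨⟨basisVec n, hmem⟩, rfl, ?_⟩
  exact Subtype.ext (funext fun k => (jacobiBasisVec_apply n k).symm)

theorem graph_jacobiZero_le :
    (jacobiZero lam w).graph ≤
      Submodule.span ℂ (Set.range fun n => (basisVec n, jacobiBasisVec lam w n)) := by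
  rintro ⟨x, y⟩ hxy
  obtain ⟨⟨a, ha⟩, hax, hay⟩ := (LinearPMap.mem_graph_iff _).1 hxy
  obtain rfl : a = x := hax
  have hspan : ∀ b ∈ finiteSpan, ∃ c,
      (b, c) ∈ Submodule.span ℂ (Set.range fun n => (basisVec n, jacobiBasisVec lam w n)) := by
    intro b hb
    induction hb using Submodule.span_induction with
    | mem b hb =>
      obtain ⟨n, rfl⟩ := hb
      exact ⟨_, Submodule.subset_span ⟨n, rfl⟩⟩
    | zero => exact ⟨0, Submodule.zero_mem _⟩
    | add b b' _ _ h h' =>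
      obtain ⟨c, hc⟩ := h
      obtain ⟨c', hc'⟩ := h'
      exact ⟨_, Submodule.add_mem _ hc hc'⟩
    | smul r b _ h =>
      obtain ⟨c, hc⟩ := h
      exact ⟨_, Submodule.smul_mem _ r hc⟩
  obtain ⟨c, hc⟩ := hspan a ha.1
  have hle : Submodule.span ℂ (Set.range fun n => (basisVec n, jacobiBasisVec lam w n)) ≤
      (jacobiZero lam w).graph := by
    rw [Submodule.span_le]
    rintro _ ⟨n, rfl⟩
    exact mem_graph_jacobiZero n
  rwa [LinearPMap.mem_graph_snd_inj _ hxy (hle hc) rfl]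

theorem graph_jacobiMin : (jacobiMin lam w).graph = (jacobiZero lam w).graph.topologicalClosure :=
  (jacobiZero_isClosable lam w).graph_closure_eq_closure_graph.symm

theorem mem_graph_jacobiMin (n : ℤ) :
    (basisVec n, jacobiBasisVec lam w n) ∈ (jacobiMin lam w).graph := by
  rw [graph_jacobiMin]
  exact Submodule.le_topologicalClosure _ (mem_graph_jacobiZero n)

theorem graph_jacobiMin_le {p : Submodule ℂ (EllTwo × EllTwo)}
    (hp : IsClosed (p : Set (EllTwo × EllTwo)))
    (h : ∀ n, (basisVec n, jacobiBasisVec lam w n) ∈ p) : (jacobiMin lam w).graph ≤ p := by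
  rw [graph_jacobiMin]
  refine Submodule.topologicalClosure_minimal _ (graph_jacobiZero_le.trans ?_) hp
  rw [Submodule.span_le]
  rintro _ ⟨n, rfl⟩
  exact h n

/-- The graph of J_min is the closed span of the pairs (e_n, 𝒥e_n), so a continuous linear relation
need only be checked on these pairs. -/
theorem eq_of_mem_graph_jacobiMin {V : Type*} [NormedAddCommGroup V] [NormedSpace ℂ V]
    {A B : EllTwo →L[ℂ] V} (h : ∀ n, B (jacobiBasisVec lam w n) = A (basisVec n)) {x y : EllTwo}
    (hxy : (x, y) ∈ (jacobiMin lam w).graph) : B y = A x := by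
  let D : EllTwo × EllTwo →L[ℂ] V :=
    B.comp (ContinuousLinearMap.snd ℂ EllTwo EllTwo) -
      A.comp (ContinuousLinearMap.fst ℂ EllTwo EllTwo)
  have : (x, y) ∈ LinearMap.ker (D : EllTwo × EllTwo →ₗ[ℂ] V) :=
    graph_jacobiMin_le D.isClosed_ker (fun n => sub_eq_zero.2 (h n)) hxy
  exact sub_eq_zero.1 this

theorem jacobiMin_le_jacobiMax : jacobiMin lam w ≤ jacobiMax lam w :=
  LinearPMap.le_of_le_graph <| graph_jacobiMin_le (jacobiMax_isClosed lam w) fun n =>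
    mem_graph_jacobiMax.2 fun k => (jacobiBasisVec_apply n k).symm

theorem pairing_jacobiBasisVec (y : EllTwo) (n : ℤ) :
    pairing y (jacobiBasisVec lam w n) = formalJacobi lam w y n := by
  simp [jacobiBasisVec, pairing_basisVec, formalJacobi_apply]

theorem pairing_symm {x x' y y' : EllTwo} (hx : (x, x') ∈ (jacobiMin lam w).graph)
    (hy : (y, y') ∈ (jacobiMax lam w).graph) : pairing y x' = pairing y' x :=
  eq_of_mem_graph_jacobiMin (fun n => by
    rw [pairing_jacobiBasisVec, pairing_basisVec, mem_graph_jacobiMax.1 hy]) hx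

/-! ### Wronskians with elements of the minimal domain -/

/-- The Wronskian with `y` at `n`, as a functional. -/
noncomputable def wronskianCLM (w y : ℤ → ℂ) (n : ℤ) : EllTwo →L[ℂ] ℂ :=
  w n • (y (n + 1) • coord n - y n • coord (n + 1))

theorem wronskianCLM_apply (w y : ℤ → ℂ) (n : ℤ) (x : EllTwo) :
    wronskianCLM w y n x = wronskian w x y n := by
  simp [wronskianCLM, wronskian, mul_comm]

/-- The truncation Y solves the equation except next to the cut, which leaves one boundary term.
Elements of the minimal domain contribute none at infinity. -/
theorem pairing_above {z : ℂ} {y : ℤ → ℂ} (hy : IsSol lam w z y) {n : ℤ} {Y : EllTwo}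
    (hY : ∀ k, Y k = if n < k then y k else 0) {x x' : EllTwo}
    (hx : (x, x') ∈ (jacobiMin lam w).graph) :
    pairing Y (x' - z • x) = wronskian w x y n := by
  have := eq_of_mem_graph_jacobiMin (lam := lam) (w := w) (B := pairing Y)
    (A := z • pairing Y + wronskianCLM w y n) (fun m => ?_) hx
  · rw [map_sub, this, map_smul]
    simp [wronskianCLM_apply]
  · have hm := hy m
    rw [formalJacobi_apply] at hm
    rw [pairing_jacobiBasisVec]
    simp only [add_apply, smul_apply, pairing_basisVec,
      wronskianCLM_apply, wronskian, basisVec_apply, formalJacobi_apply, hY, smul_eq_mul]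
    rcases lt_trichotomy n m with h | rfl | h
    · rcases eq_or_ne m (n + 1) with rfl | h'
      · simp at hm ⊢
        linear_combination hm
      · rw [if_pos (by omega), if_pos h, if_pos (by omega), if_neg (by omega), if_neg (by omega)]
        linear_combination hm
    · simp
    · rw [if_neg (by omega), if_neg (by omega), if_neg (by omega), if_neg (by omega),
        if_neg (by omega)]
      simp

theorem pairing_below {z : ℂ} {y : ℤ → ℂ} (hy : IsSol lam w z y) {n : ℤ} {Y : EllTwo}
    (hY : ∀ k, Y k = if k ≤ n then y k else 0) {x x' : EllTwo}
    (hx : (x, x') ∈ (jacobiMin lam w).graph) :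
    pairing Y (x' - z • x) = -wronskian w x y n := by
  have := eq_of_mem_graph_jacobiMin (lam := lam) (w := w) (B := pairing Y)
    (A := z • pairing Y - wronskianCLM w y n) (fun m => ?_) hx
  · rw [map_sub, this, map_smul]
    simp [wronskianCLM_apply]
  · have hm := hy m
    rw [formalJacobi_apply] at hm
    rw [pairing_jacobiBasisVec]
    simp only [sub_apply, smul_apply, pairing_basisVec,
      wronskianCLM_apply, wronskian, basisVec_apply, formalJacobi_apply, hY, smul_eq_mul]
    rcases lt_trichotomy n m with h | rfl | h
    · rcases eq_or_ne m (n + 1) with rfl | h'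
      · simp
      · rw [if_neg (by omega), if_neg (by omega), if_neg (by omega), if_neg (by omega),
          if_neg (by omega)]
        simp
    · simp at hm ⊢
      linear_combination hm
    · rw [if_pos (by omega), if_pos (by omega), if_pos (by omega), if_neg (by omega),
        if_neg (by omega)]
      linear_combination hm

theorem exists_ite (x : EllTwo) (p : ℤ → Prop) [DecidablePred p] :
    ∃ X : EllTwo, ∀ k, X k = if p k then x k else 0 :=
  exists_ellTwo ((summable_norm_sq x).of_nonneg_of_le (fun _ => by positivity) fun k => by
    split_ifs <;> simp)

theorem tendsto_pairing_zero {l : Filter ℤ} {Y : ℤ → EllTwo} {y u : EllTwo}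
    (hle : ∀ n k, ‖Y n k‖ ≤ ‖y k‖) (h0 : ∀ k, ∀ᶠ n in l, Y n k = 0) :
    Tendsto (fun n => pairing (Y n) u) l (𝓝 0) := by
  simp only [pairing_apply]
  rw [← tsum_zero (β := ℤ) (α := ℂ)]
  refine tendsto_tsum_of_dominated_convergence (summable_norm_mul y u) (fun k => ?_)
    (Eventually.of_forall fun n k => ?_)
  · refine tendsto_const_nhds.congr' ?_
    filter_upwards [h0 k] with n hn
    rw [hn, zero_mul]
  · rw [norm_mul]
    exact mul_le_mul_of_nonneg_right (hle n k) (norm_nonneg _)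

theorem tendsto_wronskian_atTop {z : ℂ} {y : ℤ → ℂ} (hy : IsSol lam w z y)
    (hys : Summable fun k : ℕ => ‖y k‖ ^ 2) {x x' : EllTwo}
    (hx : (x, x') ∈ (jacobiMin lam w).graph) : Tendsto (wronskian w x y) atTop (𝓝 0) := by
  -- Square-summability is known only towards +∞; cutting at 0 gives an ℓ² vector without affecting
  -- the tails, whose pairings tend to 0.
  obtain ⟨y₀, hy₀⟩ := exists_ellTwo (x := fun k => if 0 ≤ k then y k else 0) (by
    refine Summable.of_nat_of_neg_add_one (by simpa using hys) ?_
    refine summable_zero.congr fun k => ?_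
    rw [if_neg (by omega)]; simp)
  choose Y hY using fun n : ℤ => exists_ite y₀ fun k => n < k
  refine (tendsto_pairing_zero (l := atTop) (Y := Y) (y := y₀) (u := x' - z • x)
    (fun n k => ?_) fun k => ?_).congr' ?_
  · rw [hY]; split_ifs <;> simp
  · filter_upwards [eventually_ge_atTop k] with n hn
    rw [hY, if_neg (by omega)]
  · filter_upwards [eventually_ge_atTop 0] with n hn
    refine pairing_above hy (fun k => ?_) hx
    rw [hY, hy₀]
    by_cases h : n < k
    · rw [if_pos h, if_pos h, if_pos (by omega)]
    · rw [if_neg h, if_neg h]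

theorem tendsto_wronskian_atBot {z : ℂ} {y : ℤ → ℂ} (hy : IsSol lam w z y)
    (hys : Summable fun k : ℕ => ‖y (-k)‖ ^ 2) {x x' : EllTwo}
    (hx : (x, x') ∈ (jacobiMin lam w).graph) : Tendsto (wronskian w x y) atBot (𝓝 0) := by
  obtain ⟨y₀, hy₀⟩ := exists_ellTwo (x := fun k => if k ≤ 0 then y k else 0) (by
    refine Summable.of_nat_of_neg ?_ (by simpa using hys)
    refine summable_of_ne_finset_zero (s := {0}) fun k hk => ?_
    rw [Finset.mem_singleton] at hk
    rw [if_neg (by omega)]; simp)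
  choose Y hY using fun n : ℤ => exists_ite y₀ fun k => k ≤ n
  have := (tendsto_pairing_zero (l := atBot) (Y := Y) (y := y₀) (u := x' - z • x)
    (fun n k => ?_) fun k => ?_).neg
  · rw [neg_zero] at this
    refine this.congr' ?_
    filter_upwards [eventually_le_atBot 0] with n hn
    rw [neg_eq_iff_eq_neg]
    refine pairing_below hy (fun k => ?_) hx
    rw [hY, hy₀]
    by_cases h : k ≤ n
    · rw [if_pos h, if_pos h, if_pos (by omega)]
    · rw [if_neg h, if_neg h]
  · rw [hY]; split_ifs <;> simp
  · filter_upwards [eventually_lt_atBot k] with n hn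
    rw [hY, if_neg (by omega)]

end DoublyInfiniteJacobi

namespace DoublyInfiniteJacobi

/-! ### Resolvents in terms of graphs -/

section Operators

variable {H : Type*} [NormedAddCommGroup H] [NormedSpace ℂ H] {A : H →ₗ.[ℂ] H} {z : ℂ}
  {R : H →L[ℂ] H}

theorem isResolventAt_iff : IsResolventAt A z R ↔
    (∀ y, (R y, y + z • R y) ∈ A.graph) ∧ ∀ x x', (x, x') ∈ A.graph → R (x' - z • x) = x := by
  constructor
  · rintro ⟨h1, h2⟩
    refine ⟨fun y => ?_, fun x x' hx => ?_⟩
    · obtain ⟨h, hy⟩ := h1 y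
      exact (LinearPMap.mem_graph_iff _).2 ⟨⟨R y, h⟩, rfl, eq_add_of_sub_eq hy⟩
    · obtain ⟨a, rfl, rfl⟩ := (LinearPMap.mem_graph_iff _).1 hx
      exact h2 a
  · rintro ⟨h1, h2⟩
    refine ⟨fun y => ?_, fun x => h2 _ _ (A.mem_graph x)⟩
    obtain ⟨a, ha, ha'⟩ := (LinearPMap.mem_graph_iff _).1 (h1 y)
    simp only at ha ha'
    have hmem : R y ∈ A.domain := ha ▸ a.2
    refine ⟨hmem, ?_⟩
    rw [show (⟨R y, hmem⟩ : A.domain) = a from Subtype.ext ha.symm, ha', add_sub_cancel_right]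

theorem mem_eigenspace_iff {v : H} : v ∈ eigenspace A z ↔ (v, z • v) ∈ A.graph := by
  rw [LinearPMap.mem_graph_iff]
  constructor
  · rintro ⟨a, ha, rfl⟩
    exact ⟨a, rfl, sub_eq_zero.1 ha⟩
  · rintro ⟨a, ha, ha'⟩
    simp only at ha ha'
    refine ⟨a, ?_, ha⟩
    change A a - z • (a : H) = 0
    rw [ha', ha, sub_self]

end Operators

/-! ### The Green operator -/

variable {lam w : ℤ → ℂ} {z z' : ℂ} {δ : ℝ}

/-- The `n`-th coordinate of `𝒥`. -/
noncomputable def jacobiCoord (lam w : ℤ → ℂ) (n : ℤ) : EllTwo →L[ℂ] ℂ :=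
  w (n - 1) • coord (n - 1) + lam n • coord n + w n • coord (n + 1)

theorem exists_green_operator (hw : ∀ n, w n ≠ 0) (hδ : 0 < δ) (hz : ∀ n, δ ≤ ‖z - lam n‖)
    (ht : Summable fun n => ‖edge lam w z n‖) (hF : sparseSum (edge lam w z) ≠ 0) :
    ∃ R : EllTwo →L[ℂ] EllTwo,
      (∀ y, (R y, y + z • R y) ∈ (jacobiMax lam w).graph) ∧
      ∀ n, R (jacobiBasisVec lam w n) = z • R (basisVec n) + basisVec n := by
  obtain ⟨f, g, C, hf, hg, hW, hdecay, -, -⟩ := exists_weyl_solutions hw hδ hz ht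
  set F := sparseSum (edge lam w z)
  -- The sign is fixed by the diagonal: there (𝒥-z)G equals F⁻¹ times the Wronskian of f and g,
  -- which is 1.
  let G : ℤ → ℤ → ℂ := fun m n => -F⁻¹ * if m ≤ n then g m * f n else g n * f m
  have hGle : ∀ m n, m ≤ n → G m n = -F⁻¹ * (g m * f n) := fun m n h => by
    simp only [G]; rw [if_pos h]
  have hGsymm : ∀ m n, G m n = G n m := fun m n => by
    simp only [G]
    rcases lt_trichotomy m n with h | rfl | h
    · rw [if_pos h.le, if_neg (by omega)]
    · rfl
    · rw [if_neg (by omega), if_pos h.le]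
  have hbound' : ∀ m n, m ≤ n → ‖G m n‖ ≤ ‖F⁻¹‖ * C * (1 / 2) ^ (n - m).natAbs := by
    intro m n h
    obtain ⟨d, rfl⟩ := Int.le.dest h
    rw [hGle _ _ h, norm_mul, norm_neg, mul_assoc]
    refine mul_le_mul_of_nonneg_left ?_ (norm_nonneg _)
    simpa using hdecay m d
  have hbound : ∀ m n, ‖G m n‖ ≤ ‖F⁻¹‖ * C * (1 / 2) ^ (n - m).natAbs := by
    intro m n
    rcases le_total m n with h | h
    · exact hbound' m n h
    · rw [hGsymm, ← Int.natAbs_neg, neg_sub]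
      exact hbound' n m h
  have hK : ∀ m n, w (m - 1) * G (m - 1) n + lam m * G m n + w m * G (m + 1) n =
      z * G m n + if m = n then 1 else 0 := by
    intro m n
    have hgm := hg m
    have hfm := hf m
    rw [formalJacobi_apply] at hgm hfm
    rcases lt_trichotomy m n with h | rfl | h
    · rw [hGle _ _ h.le, hGle (m - 1) n (by omega), hGle (m + 1) n (by omega), if_neg h.ne]
      linear_combination (-F⁻¹ * f n) * hgm
    · rw [hGle _ _ le_rfl, hGle (m - 1) m (by omega), hGsymm (m + 1) m, hGle m (m + 1) (by omega),
        if_pos rfl]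
      have hWm := hW m
      rw [wronskian] at hWm
      have hFF : F⁻¹ * F = 1 := inv_mul_cancel₀ hF
      linear_combination (-F⁻¹ * f m) * hgm + F⁻¹ * hWm + hFF
    · rw [hGsymm m n, hGle _ _ h.le, hGsymm (m - 1), hGle n (m - 1) (by omega), hGsymm (m + 1),
        hGle n (m + 1) (by omega), if_neg h.ne']
      linear_combination (-F⁻¹ * g n) * hfm
  obtain ⟨R, hR⟩ := exists_kernel_operator hbound
  refine ⟨R, fun y => mem_graph_jacobiMax.2 fun m => ?_, fun n => ?_⟩
  · have : (jacobiCoord lam w m).comp R = z • (coord m).comp R + coord m := clm_ext fun n => by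
      change formalJacobi lam w (R (basisVec n)) m = z * R (basisVec n) m + basisVec n m
      rw [formalJacobi_apply, hR, hR, hR, basisVec_apply]
      exact hK m n
    have h := DFunLike.congr_fun this y
    change formalJacobi lam w (R y) m = z * R y m + y m at h
    rw [h, add_comm]
    rfl
  -- By symmetry of the kernel, the equation in the first index also holds in the second, which
  -- makes R a left inverse on basis vectors.
  · refine lp.ext (funext fun m => ?_)
    change coord m (R (jacobiBasisVec lam w n)) = coord m (z • R (basisVec n) + basisVec n)
    rw [jacobiBasisVec]
    simp only [map_add, map_smul, coord_apply, smul_eq_mul]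
    rw [hR, hR, hR, basisVec_apply, hGsymm m (n - 1), hGsymm m n, hGsymm m (n + 1), hK n m]
    exact congrArg _ (if_congr eq_comm rfl rfl)

/-! ### Injectivity, equality of the two operators, simplicity of eigenvalues -/

theorem summable_sq_of_le {x : ℕ → ℝ} {C : ℝ} (h0 : ∀ d, 0 ≤ x d)
    (h : ∀ d, x d ≤ C * (1 / 2) ^ d) : Summable fun d => x d ^ 2 := by
  have hs : Summable fun d : ℕ => C ^ 2 * (1 / 4 : ℝ) ^ d :=
    (summable_geometric_of_lt_one (by norm_num) (by norm_num)).mul_left _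
  refine hs.of_nonneg_of_le (fun d => sq_nonneg _) fun d => ?_
  calc x d ^ 2 ≤ (C * (1 / 2) ^ d) ^ 2 := pow_le_pow_left₀ (h0 d) (h d) 2
    _ = C ^ 2 * (1 / 4) ^ d := by
      rw [mul_pow, ← pow_mul, mul_comm d 2, pow_mul]; norm_num

theorem isSol_of_mem_graph {x : EllTwo} (hx : (x, z • x) ∈ (jacobiMax lam w).graph) :
    IsSol lam w z x := fun n => mem_graph_jacobiMax.1 hx n

/-- If `J_min` has an eigenvalue, then `J_max - z` is injective wherever `F` does not vanish. -/
theorem eq_zero_of_isSol (hw : ∀ n, w n ≠ 0) (hδ : 0 < δ) (hz : ∀ n, δ ≤ ‖z - lam n‖)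
    (ht : Summable fun n => ‖edge lam w z n‖) (hF : sparseSum (edge lam w z) ≠ 0)
    {v : EllTwo} (hv : (v, z' • v) ∈ (jacobiMin lam w).graph) (hv0 : v ≠ 0)
    {h : EllTwo} (hh : IsSol lam w z h) : h = 0 := by
  obtain ⟨f, g, C, hf, hg, hW, -, hfd, hgd⟩ := exists_weyl_solutions hw hδ hz ht
  have hvs : IsSol lam w z' v :=
    isSol_of_mem_graph (LinearPMap.le_graph_of_le jacobiMin_le_jacobiMax hv)
  have hv0' : (v : ℤ → ℂ) ≠ 0 := fun h => hv0 (lp.ext h)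
  have hhp : Summable fun k : ℕ => ‖h k‖ ^ 2 :=
    (summable_norm_sq h).comp_injective Nat.cast_injective
  have hhm : Summable fun k : ℕ => ‖h (-k)‖ ^ 2 :=
    (summable_norm_sq h).comp_injective (i := fun k : ℕ => -(k : ℤ)) fun i j hij => by
      simpa using hij
  have hfs := summable_sq_of_le (fun _ => norm_nonneg _) hfd
  have hgs := summable_sq_of_le (fun _ => norm_nonneg _) hgd
  -- If f and h were independent, both being square-summable at +∞, the eigenvector v would vanish.
  -- The same reasoning at -∞ applies to g and h.
  have h1 : wronskian w f h 0 = 0 := by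
    by_contra hc
    exact hv0' (hvs.eq_zero_of_tendsto_atTop hw hf hh hc hfs hhp
      (tendsto_wronskian_atTop hf hfs hv) (tendsto_wronskian_atTop hh hhp hv))
  have h2 : wronskian w g h 0 = 0 := by
    by_contra hc
    exact hv0' (hvs.eq_zero_of_tendsto_atBot hw hg hh hc hgs hhm
      (tendsto_wronskian_atBot hg hgs hv) (tendsto_wronskian_atBot hh hhm hv))
  refine lp.ext (funext fun n => ?_)
  have key := wronskian_mul_apply w f g h n
  rw [wronskian_swap w h g, wronskian_swap w h f, wronskian_eq_of_isSol hg hh n 0,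
    wronskian_eq_of_isSol hf hh n 0, h1, h2, hW] at key
  simpa [hF] using key

theorem jacobiMin_eq_jacobiMax (hw : ∀ n, w n ≠ 0) (hδ : 0 < δ) (hz : ∀ n, δ ≤ ‖z - lam n‖)
    (ht : Summable fun n => ‖edge lam w z n‖) (hF : sparseSum (edge lam w z) ≠ 0)
    {v : EllTwo} (hv : (v, z' • v) ∈ (jacobiMin lam w).graph) (hv0 : v ≠ 0) :
    jacobiMin lam w = jacobiMax lam w ∧ z ∈ resolventSet (jacobiMin lam w) := by
  obtain ⟨R, hR1, hR2⟩ := exists_green_operator hw hδ hz ht hF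
  have hker : ∀ {h : EllTwo}, IsSol lam w z h → h = 0 := eq_zero_of_isSol hw hδ hz ht hF hv hv0
  have hleft : ∀ x x', (x, x') ∈ (jacobiMax lam w).graph → R (x' - z • x) = x := by
    intro x x' hx
    have hmem := Submodule.sub_mem _ (hR1 (x' - z • x)) hx
    refine sub_eq_zero.1 (hker (isSol_of_mem_graph ?_))
    convert hmem using 1
    refine Prod.ext rfl ?_
    simp only [Prod.snd_sub, smul_sub]
    abel
  let Φ : EllTwo →L[ℂ] EllTwo × EllTwo := R.prod (ContinuousLinearMap.id ℂ EllTwo + z • R)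
  -- K consists of the y for which R y solves the resolvent equation already inside J_min. It is
  -- closed and contains every (𝒥-z)e_n; a vector orthogonal to all of these is the conjugate of an
  -- ℓ² solution, hence zero.
  let K : Submodule ℂ EllTwo := (jacobiMin lam w).graph.comap (Φ : EllTwo →ₗ[ℂ] EllTwo × EllTwo)
  have hKclosed : IsClosed (K : Set EllTwo) := by
    have : IsClosed ((jacobiMin lam w).graph : Set (EllTwo × EllTwo)) := by
      rw [graph_jacobiMin]
      exact Submodule.isClosed_topologicalClosure _
    exact this.preimage Φ.continuous
  have hKmem : ∀ n, jacobiBasisVec lam w n - z • basisVec n ∈ K := fun n => by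
    have hRn : R (jacobiBasisVec lam w n - z • basisVec n) = basisVec n := by
      rw [map_sub, hR2, map_smul, add_sub_cancel_left]
    change (R _, _ + z • R _) ∈ (jacobiMin lam w).graph
    rw [hRn]
    simpa using mem_graph_jacobiMin n
  have hKtop : K = ⊤ := by
    have hc : IsClosed (K : Set EllTwo) := hKclosed
    have : CompleteSpace K := hKclosed.completeSpace_coe
    rw [← Submodule.orthogonal_eq_bot_iff, Submodule.eq_bot_iff]
    intro u hu
    have hs : star u = 0 := hker fun n => by
      have h0 := (Submodule.mem_orthogonal' K u).1 hu _ (hKmem n)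
      have h1 : pairing (star u) (jacobiBasisVec lam w n - z • basisVec n) = 0 := by
        rw [pairing_eq_inner, star_star]
        exact h0
      rw [map_sub, map_smul, pairing_jacobiBasisVec, pairing_basisVec, sub_eq_zero] at h1
      exact h1
    exact star_eq_zero.1 hs
  have heq : jacobiMin lam w = jacobiMax lam w := by
    refine le_antisymm jacobiMin_le_jacobiMax (LinearPMap.le_of_le_graph ?_)
    rintro ⟨x, x'⟩ hx
    have hmem : x' - z • x ∈ K := hKtop ▸ Submodule.mem_top
    change (R (x' - z • x), x' - z • x + z • R (x' - z • x)) ∈ (jacobiMin lam w).graph at hmem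
    rwa [hleft x x' hx, sub_add_cancel] at hmem
  refine ⟨heq, R, isResolventAt_iff.2 ?_⟩
  rw [heq]
  exact ⟨hR1, hleft⟩

/-- The Wronskian of two solutions is constant, and at +∞ it tends to 0 on the minimal domain. -/
theorem wronskian_eq_zero_of_mem_graph {x y : EllTwo} (hx : (x, z • x) ∈ (jacobiMin lam w).graph)
    (hy : (y, z • y) ∈ (jacobiMin lam w).graph) : wronskian w x y 0 = 0 := by
  have hle := LinearPMap.le_graph_of_le (jacobiMin_le_jacobiMax (lam := lam) (w := w))
  have hxs := isSol_of_mem_graph (hle hx)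
  have hys := isSol_of_mem_graph (hle hy)
  have hlim := tendsto_wronskian_atTop hys
    ((summable_norm_sq y).comp_injective Nat.cast_injective) hx
  rw [show wronskian w x y = fun _ => wronskian w x y 0 from
    funext fun n => wronskian_eq_of_isSol hxs hys n 0] at hlim
  exact tendsto_nhds_unique tendsto_const_nhds hlim

theorem rank_eigenspace_le_one (hw : ∀ n, w n ≠ 0) :
    Module.rank ℂ (eigenspace (jacobiMin lam w) z) ≤ 1 := by
  rw [rank_submodule_le_one_iff]
  have hle := LinearPMap.le_graph_of_le (jacobiMin_le_jacobiMax (lam := lam) (w := w))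
  have hzero : ∀ x : EllTwo, (x, z • x) ∈ (jacobiMin lam w).graph → x 0 = 0 → x 1 = 0 → x = 0 :=
    fun x hx h0 h1 => lp.ext ((isSol_of_mem_graph (hle hx)).eq_zero hw h0 h1)
  by_cases hv : ∃ v ∈ eigenspace (jacobiMin lam w) z, v ≠ 0
  · obtain ⟨v, hv, hv0⟩ := hv
    refine ⟨v, hv, fun x hx => ?_⟩
    have hxg := mem_eigenspace_iff.1 hx
    have hvg := mem_eigenspace_iff.1 hv
    have hW := wronskian_eq_zero_of_mem_graph hxg hvg
    rw [wronskian, mul_eq_zero, or_iff_right (hw 0), zero_add] at hW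
    have key : ∀ c : ℂ, x 0 = c * v 0 → x 1 = c * v 1 → x ∈ Submodule.span ℂ {v} := by
      intro c h0 h1
      have hsub : x - c • v = 0 := by
        refine hzero _ (mem_eigenspace_iff.1 (Submodule.sub_mem _ hx (Submodule.smul_mem _ c hv)))
          ?_ ?_
        · change x 0 - c * v 0 = 0
          rw [h0, sub_self]
        · change x 1 - c * v 1 = 0
          rw [h1, sub_self]
      exact Submodule.mem_span_singleton.2 ⟨c, (sub_eq_zero.1 hsub).symm⟩
    by_cases h0 : v 0 = 0
    · have h1 : v 1 ≠ 0 := fun h1 => hv0 (hzero v hvg h0 h1)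
      refine key (x 1 / v 1) ?_ (by field_simp)
      field_simp
      linear_combination hW
    · refine key (x 0 / v 0) (by field_simp) ?_
      field_simp
      linear_combination -hW
  · push Not at hv
    exact ⟨0, Submodule.zero_mem _, fun x hx => by rw [hv x hx]; exact Submodule.zero_mem _⟩

end DoublyInfiniteJacobi

namespace DoublyInfiniteJacobi

/-! ### The characteristic function -/

variable {lam w : ℤ → ℂ} {z z₀ : ℂ}

theorem isOpen_compl0 : IsOpen (compl0 lam) := isClosed_closure.isOpen_compl

theorem exists_le_norm_sub (hz : z ∈ compl0 lam) : ∃ δ > 0, ∀ n, δ ≤ ‖z - lam n‖ := by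
  obtain ⟨δ, hδ, hball⟩ := Metric.isOpen_iff.1 isOpen_compl0 z hz
  refine ⟨δ, hδ, fun n => ?_⟩
  by_contra hlt
  rw [not_le, ← dist_eq_norm, dist_comm] at hlt
  exact hball hlt (subset_closure ⟨n, rfl⟩)

/-- The ratio ‖z₀-λ_n‖/‖ξ-λ_n‖ is bounded uniformly in n and locally uniformly in ξ. Convergence at
one point thus spreads to ℂ₀^λ, with a local majorant that makes F analytic. -/
theorem norm_edge_le {ξ : ℂ} {δ M : ℝ} (hδ : 0 < δ) (hξ : ∀ n, δ ≤ ‖ξ - lam n‖)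
    (hM : ‖ξ - z₀‖ ≤ M) (hz₀ : ∀ n, z₀ - lam n ≠ 0) (n : ℤ) :
    ‖edge lam w ξ n‖ ≤ (1 + M / δ) ^ 2 * ‖edge lam w z₀ n‖ := by
  have hM0 : 0 ≤ M := (norm_nonneg _).trans hM
  have h1 : ∀ n, ‖z₀ - lam n‖ ≤ (1 + M / δ) * ‖ξ - lam n‖ := fun n => by
    have h2 : ‖z₀ - lam n‖ ≤ ‖ξ - lam n‖ + ‖ξ - z₀‖ := by
      rw [show z₀ - lam n = (ξ - lam n) - (ξ - z₀) by ring]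
      exact norm_sub_le _ _
    have h3 : M ≤ M / δ * ‖ξ - lam n‖ := by
      rw [div_mul_eq_mul_div, le_div_iff₀ hδ]
      exact mul_le_mul_of_nonneg_left (hξ n) hM0
    linarith
  have hp : ∀ n, 0 < ‖ξ - lam n‖ := fun n => hδ.trans_le (hξ n)
  have hq : ∀ n, 0 < ‖z₀ - lam n‖ := fun n => norm_pos_iff.2 (hz₀ n)
  have hpn := hp n
  have hpn' := hp (n + 1)
  have hqn := hq n
  have hqn' := hq (n + 1)
  simp only [edge, norm_div, norm_mul, norm_pow]
  rw [mul_div_assoc', div_le_div_iff₀ (by positivity) (by positivity)]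
  have := mul_le_mul (h1 n) (h1 (n + 1)) (norm_nonneg _) (by positivity)
  calc ‖w n‖ ^ 2 * (‖z₀ - lam n‖ * ‖z₀ - lam (n + 1)‖)
      ≤ ‖w n‖ ^ 2 * ((1 + M / δ) * ‖ξ - lam n‖ * ((1 + M / δ) * ‖ξ - lam (n + 1)‖)) := by gcongr
    _ = _ := by ring

theorem sub_ne_zero_of_mem_compl0 (hz : z ∈ compl0 lam) (n : ℤ) : z - lam n ≠ 0 := fun h =>
  hz (subset_closure ⟨n, (sub_eq_zero.1 h).symm⟩)

theorem SummableAt.summable_edge (h : SummableAt lam w z₀) :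
    Summable fun n => ‖edge lam w z₀ n‖ :=
  h.congr fun n => by
    rw [edge, ← neg_sub z₀ (lam n), ← neg_sub z₀ (lam (n + 1)), neg_mul_neg]

theorem summable_edge (hz₀ : z₀ ∈ compl0 lam) (h : SummableAt lam w z₀) (hz : z ∈ compl0 lam) :
    Summable fun n => ‖edge lam w z n‖ := by
  obtain ⟨δ, hδ, hle⟩ := exists_le_norm_sub hz
  exact (h.summable_edge.mul_left _).of_nonneg_of_le (fun _ => norm_nonneg _)
    (norm_edge_le hδ hle le_rfl (sub_ne_zero_of_mem_compl0 hz₀))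

theorem differentiableOn_sparseSum_edge (hz₀ : z₀ ∈ compl0 lam) (h : SummableAt lam w z₀) :
    DifferentiableOn ℂ (fun ξ => sparseSum (edge lam w ξ)) (compl0 lam) := by
  intro z hz
  obtain ⟨δ, hδ, hle⟩ := exists_le_norm_sub hz
  have hδ2 : 0 < δ / 2 := by positivity
  have hle' : ∀ ξ ∈ Metric.ball z (δ / 2), ∀ n, δ / 2 ≤ ‖ξ - lam n‖ := fun ξ hξ n => by
    have h1 : ‖z - lam n‖ ≤ ‖ξ - lam n‖ + ‖ξ - z‖ := by
      rw [show z - lam n = (ξ - lam n) - (ξ - z) by ring]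
      exact norm_sub_le _ _
    rw [mem_ball_iff_norm] at hξ
    linarith [hle n]
  have hdiff : DifferentiableOn ℂ (fun ξ => sparseSum (edge lam w ξ)) (Metric.ball z (δ / 2)) := by
    set K : ℝ := (1 + (δ / 2 + ‖z - z₀‖) / (δ / 2)) ^ 2
    refine Complex.differentiableOn_tsum_of_summable_norm
      (u := fun S : Finset ℤ => ∏ k ∈ S, K * ‖edge lam w z₀ k‖)
      (summable_finsetProd_of_summable_nonneg (fun k => by positivity)
        (h.summable_edge.mul_left K)) (fun S => ?_) Metric.isOpen_ball fun S ξ hξ => ?_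
    · unfold sparseTerm
      split_ifs
      · refine DifferentiableOn.fun_finsetProd fun k _ => ?_
        unfold edge
        refine DifferentiableOn.fun_neg (DifferentiableOn.fun_div (by fun_prop) (by fun_prop) ?_)
        intro ξ hξ
        exact mul_ne_zero (norm_pos_iff.1 (hδ2.trans_le (hle' ξ hξ k)))
          (norm_pos_iff.1 (hδ2.trans_le (hle' ξ hξ (k + 1))))
      · exact differentiableOn_const 0
    · refine norm_sparseTerm_le_of_le (norm_edge_le hδ2 (hle' ξ hξ) ?_
        (sub_ne_zero_of_mem_compl0 hz₀)) S
      have h1 : ‖ξ - z₀‖ ≤ ‖ξ - z‖ + ‖z - z₀‖ := by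
        rw [show ξ - z₀ = (ξ - z) + (z - z₀) by ring]
        exact norm_add_le _ _
      rw [mem_ball_iff_norm] at hξ
      linarith
  exact (hdiff.differentiableAt (Metric.ball_mem_nhds z hδ2)).differentiableWithinAt

theorem charFun_eq_sparseSum {γ : ℤ → ℂ} (hγ : ∀ n, γ n * γ (n + 1) = w n)
    (hs : Summable fun n => ‖edge lam w z n‖) :
    charFun lam γ z = sparseSum (edge lam w z) := by
  have h : (fun k => γ k ^ 2 / (z - lam k) * (γ (k + 1) ^ 2 / (z - lam (k + 1)))) =
      edge lam w z := funext fun k => by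
    rw [edge, ← hγ, div_mul_div_comm, mul_pow]
  rw [charFun, frakF_eq_sparseSum (x := fun n => γ n ^ 2 / (z - lam n)), h]
  rw [← h] at hs
  exact hs

/-! ### Connectedness -/

/-- The ball is homeomorphic to ℂ, where the complement of a countable set is connected. -/
theorem isPreconnected_ball_diff_countable {C : Set ℂ} (hC : C.Countable) (c : ℂ) {r : ℝ}
    (hr : 0 < r) : IsPreconnected (Metric.ball c r \ C) := by
  let e := OpenPartialHomeomorph.univBall c r
  have hinj : Function.Injective e := fun x y hxy => e.injOn (by simp [e]) (by simp [e]) hxy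
  have himg : Metric.ball c r \ C = e '' (e ⁻¹' C)ᶜ := by
    have hrange : Set.range e = Metric.ball c r := by
      rw [← Set.image_univ, ← OpenPartialHomeomorph.univBall_target c hr, ← e.image_source_eq_target,
        OpenPartialHomeomorph.univBall_source]
    rw [← Set.preimage_compl, Set.image_preimage_eq_inter_range, hrange, Set.inter_comm]
    rfl
  rw [himg]
  exact ((hC.preimage hinj).isConnected_compl_of_one_lt_rank
    (by simp [Complex.rank_real_complex])).isPreconnected.image _
    (OpenPartialHomeomorph.continuous_univBall c r).continuousOn

theorem isPreconnected_diff_countable {U C : Set ℂ} (hU : IsOpen U) (hpre : IsPreconnected U)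
    (hC : C.Countable) : IsPreconnected (U \ C) := by
  rintro u v hu hv hsub ⟨a, ha, hau⟩ ⟨b, hb, hbv⟩
  by_contra hempty
  rw [Set.not_nonempty_iff_eq_empty] at hempty
  -- Small balls minus C are connected, so near each point of U the set U \ C lies wholly in u or
  -- wholly in v. The open sets `loc u` and `loc v` therefore cover U; if u and v did not meet in U
  -- \ C, C would contain a neighbourhood of a common point.
  let loc : Set ℂ → Set ℂ := fun s => {x | ∀ᶠ y in 𝓝 x, y ∈ U \ C → y ∈ s}
  have hopen : ∀ s, IsOpen (loc s) := fun s =>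
    isOpen_iff_mem_nhds.2 fun x hx => eventually_eventually_nhds.2 hx
  have hcover : U ⊆ loc u ∪ loc v := by
    intro x hx
    obtain ⟨r, hr, hball⟩ := Metric.isOpen_iff.1 hU x hx
    have hsubU : Metric.ball x r \ C ⊆ U \ C := Set.sdiff_subset_sdiff_left hball
    have hmem := Metric.ball_mem_nhds x hr
    rcases isPreconnected_iff_subset_of_disjoint.1 (isPreconnected_ball_diff_countable hC x hr)
      u v hu hv (hsubU.trans hsub)
      (Set.subset_empty_iff.1 (hempty ▸ Set.inter_subset_inter_left _ hsubU)) with h | h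
    · exact Or.inl (Filter.mem_of_superset hmem fun y hy hyS => h ⟨hy, hyS.2⟩)
    · exact Or.inr (Filter.mem_of_superset hmem fun y hy hyS => h ⟨hy, hyS.2⟩)
  obtain ⟨x, hxU, hxu, hxv⟩ := hpre _ _ (hopen u) (hopen v) hcover
    ⟨a, ha.1, Filter.mem_of_superset (hu.mem_nhds hau) fun y hy _ => hy⟩
    ⟨b, hb.1, Filter.mem_of_superset (hv.mem_nhds hbv) fun y hy _ => hy⟩
  have hall : ∀ᶠ y in 𝓝 x, y ∈ C := by
    filter_upwards [hxu, hxv, hU.mem_nhds hxU] with y h1 h2 h3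
    by_contra hy
    have : y ∈ U \ C ∩ (u ∩ v) := ⟨⟨h3, hy⟩, h1 ⟨h3, hy⟩, h2 ⟨h3, hy⟩⟩
    rw [hempty] at this
    exact this
  obtain ⟨y, hy, hyC⟩ := (mem_closure_iff_nhds.1 (hC.dense_compl ℝ x)) _ hall
  exact hyC hy

/-- The closure of the range is the range together with der λ: near any other point only finitely
many indices contribute, and their values can be avoided. -/
theorem compl0_eq : compl0 lam = (der lam)ᶜ \ Set.range lam := by
  rw [compl0, Set.sdiff_eq, ← Set.compl_union, compl_inj_iff]
  refine Set.Subset.antisymm (fun x hx => ?_) (Set.union_subset (fun x hx => ?_) subset_closure)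
  · by_contra hcon
    rw [Set.mem_union, not_or] at hcon
    obtain ⟨hder, hran⟩ := hcon
    change ¬ MapClusterPt x cofinite lam at hder
    rw [mapClusterPt_iff_frequently] at hder
    push Not at hder
    obtain ⟨s, hs, hfin⟩ := hder
    have hfin' : {n | lam n ∈ s}.Finite := by
      simpa only [Filter.eventually_cofinite, not_not] using hfin
    have hT : (lam '' {n | lam n ∈ s})ᶜ ∈ 𝓝 x :=
      (hfin'.image lam).isClosed.isOpen_compl.mem_nhds fun ⟨n, _, hn⟩ => hran ⟨n, hn⟩
    obtain ⟨_, ⟨h1, h2⟩, n, rfl⟩ := mem_closure_iff_nhds.1 hx _ (Filter.inter_mem hs hT)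
    exact h2 ⟨n, h1, rfl⟩
  · refine mem_closure_iff_nhds.2 fun s hs => ?_
    obtain ⟨n, hn⟩ := (mapClusterPt_iff_frequently.1 hx s hs).exists
    exact ⟨lam n, hn, n, rfl⟩

theorem isPreconnected_compl0 (h : IsConnected (der lam)ᶜ) : IsPreconnected (compl0 lam) := by
  rw [compl0_eq]
  exact isPreconnected_diff_countable isClosed_setOfPred_clusterPt.isOpen_compl h.isPreconnected
    (Set.countable_range lam)

theorem eventually_sparseSum_edge_ne_zero (hconn : IsConnected (der lam)ᶜ) (hz₀ : z₀ ∈ compl0 lam)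
    (h : SummableAt lam w z₀) (hF : ∃ ξ ∈ compl0 lam, sparseSum (edge lam w ξ) ≠ 0)
    (hz : z ∈ compl0 lam) : ∀ᶠ ξ in 𝓝[≠] z, sparseSum (edge lam w ξ) ≠ 0 := by
  obtain ⟨ξ, hξ, hne⟩ := hF
  by_contra hcon
  exact hne (((differentiableOn_sparseSum_edge hz₀ h).analyticOnNhd isOpen_compl0
    ).eqOn_zero_of_preconnected_of_frequently_eq_zero (isPreconnected_compl0 hconn) hz
    hcon hξ)

/-! ### The Riesz projection -/

section Operators

variable {H : Type*} [NormedAddCommGroup H] [NormedSpace ℂ H] {A : H →ₗ.[ℂ] H} {ξ : ℂ}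

theorem resolventOp_spec (h : ξ ∈ resolventSet A) : IsResolventAt A ξ (resolventOp A ξ) := by
  have h' : ∃ R : H →L[ℂ] H, IsResolventAt A ξ R := h
  rw [resolventOp, dif_pos h']
  exact h'.choose_spec

theorem IsResolventAt.unique {R S : H →L[ℂ] H} (hR : IsResolventAt A ξ R)
    (hS : IsResolventAt A ξ S) : R = S := by
  rw [isResolventAt_iff] at hR hS
  ext y
  simpa using (hS.2 _ _ (hR.1 y)).symm

/-- The factorization A - ξ = (1 - (ξ-ξ₀)R)(A - ξ₀) gives the inverse at ξ. Near ξ₀ the first factor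
is invertible, whence the continuity of the resolvent. -/
theorem IsResolventAt.perturb {ξ₀ : ℂ} {R : H →L[ℂ] H} (hR : IsResolventAt A ξ₀ R)
    (hu : IsUnit (1 - (ξ - ξ₀) • R)) :
    IsResolventAt A ξ (R * Ring.inverse (1 - (ξ - ξ₀) • R)) := by
  rw [isResolventAt_iff] at hR ⊢
  set B := Ring.inverse (1 - (ξ - ξ₀) • R)
  refine ⟨fun y => ?_, fun x x' hx => ?_⟩
  · have h1 : B y - (ξ - ξ₀) • R (B y) = y :=
      DFunLike.congr_fun (Ring.mul_inverse_cancel _ hu) y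
    convert hR.1 (B y) using 1
    refine Prod.ext rfl ?_
    change y + ξ • R (B y) = B y + ξ₀ • R (B y)
    rw [sub_smul] at h1
    nth_rewrite 1 [← h1]
    abel
  · have h1 := hR.2 x x' hx
    have h2 : x' - ξ • x = (1 - (ξ - ξ₀) • R) (x' - ξ₀ • x) := by
      change _ = (x' - ξ₀ • x) - (ξ - ξ₀) • R (x' - ξ₀ • x)
      rw [h1, sub_smul]
      abel
    have h3 : B ((1 - (ξ - ξ₀) • R) (x' - ξ₀ • x)) = x' - ξ₀ • x :=
      DFunLike.congr_fun (Ring.inverse_mul_cancel _ hu) _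
    change R (B (x' - ξ • x)) = x
    rw [h2, h3, h1]

theorem continuousAt_resolventOp [CompleteSpace H] (h : ξ ∈ resolventSet A) :
    ContinuousAt (resolventOp A) ξ := by
  obtain ⟨R, hR⟩ := h
  have hcont : ContinuousAt (fun ζ : ℂ => (1 : H →L[ℂ] H) - (ζ - ξ) • R) ξ := by fun_prop
  have h1 : (1 : H →L[ℂ] H) - (ξ - ξ) • R = ((1 : (H →L[ℂ] H)ˣ) : H →L[ℂ] H) := by simp
  have hunit : ∀ᶠ ζ in 𝓝 ξ, IsUnit ((1 : H →L[ℂ] H) - (ζ - ξ) • R) := by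
    refine hcont.eventually ?_
    beta_reduce
    rw [h1]
    exact Units.nhds 1
  have hinv : ContinuousAt
      (fun ζ : ℂ => R * Ring.inverse ((1 : H →L[ℂ] H) - (ζ - ξ) • R)) ξ := by
    refine continuousAt_const.mul (ContinuousAt.comp (g := Ring.inverse) ?_ hcont)
    rw [h1]
    exact NormedRing.inverse_continuousAt 1
  refine hinv.congr ?_
  filter_upwards [hunit] with ζ hζ
  have := hR.perturb hζ
  exact this.unique (resolventOp_spec ⟨_, this⟩)

theorem IsRieszRadius.mem_resolventSet {z : ℂ} {r : ℝ} (hr : IsRieszRadius A z r)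
    (hξ : ξ ∈ Metric.sphere z r) : ξ ∈ resolventSet A := by
  by_contra hcon
  have : ξ = z := hr.2 ⟨Metric.sphere_subset_closedBall hξ, hcon⟩
  rw [this, Metric.mem_sphere, dist_self] at hξ
  exact hr.1.ne hξ

theorem map_rieszProjection [CompleteSpace H] {E : Type*} [NormedAddCommGroup E] [NormedSpace ℂ E]
    [CompleteSpace E] {z : ℂ} {r : ℝ} (hr : IsRieszRadius A z r) (L : (H →L[ℂ] H) →L[ℂ] E) :
    L (rieszProjection A z r) =
      (-(2 * (Real.pi : ℂ) * Complex.I)⁻¹) • ∮ ξ in C(z, r), L (resolventOp A ξ) := by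
  have hint : CircleIntegrable (resolventOp A) z r :=
    ContinuousOn.circleIntegrable hr.1.le fun ξ hξ =>
      (continuousAt_resolventOp (hr.mem_resolventSet hξ)).continuousWithinAt
  rw [rieszProjection, map_smul, circleIntegral, circleIntegral]
  congr 1
  rw [← L.intervalIntegral_comp_comm hint.out]
  simp only [map_smul]

/-- On an eigenvector the resolvent acts as (z-ξ)⁻¹, so the contour integral reduces to Cauchy's. -/
theorem rieszProjection_apply_eigenvector [CompleteSpace H] {z : ℂ} {r : ℝ}
    (hr : IsRieszRadius A z r) {v : H} (hv : (v, z • v) ∈ A.graph) :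
    rieszProjection A z r v = v := by
  have h := map_rieszProjection hr (ContinuousLinearMap.apply ℂ H v)
  simp only [ContinuousLinearMap.apply_apply] at h
  have hcongr : Set.EqOn (fun ξ => resolventOp A ξ v) (fun ξ => (ξ - z)⁻¹ • -v)
      (Metric.sphere z r) := by
    intro ξ hξ
    have h1 := (isResolventAt_iff.1 (resolventOp_spec (hr.mem_resolventSet hξ))).2 _ _ hv
    rw [← sub_smul, map_smul] at h1
    have hne : ξ - z ≠ 0 := by
      rw [mem_sphere_iff_norm] at hξ
      exact norm_pos_iff.1 (hξ ▸ hr.1)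
    change resolventOp A ξ v = (ξ - z)⁻¹ • -v
    rw [eq_inv_smul_iff₀ hne]
    nth_rewrite 2 [← h1]
    rw [← neg_smul, neg_sub]
  rw [h, circleIntegral.integral_congr hr.1.le hcongr, circleIntegral.integral_smul_const,
    circleIntegral.integral_sub_center_inv z hr.1.ne', smul_smul, neg_mul,
    inv_mul_cancel₀ Complex.two_pi_I_ne_zero, neg_smul_neg, one_smul]

end Operators

/-! ### Symmetry of the Riesz projection and the algebraic multiplicity -/

theorem pairing_rieszProjection (heq : jacobiMin lam w = jacobiMax lam w) {r : ℝ}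
    (hr : IsRieszRadius (jacobiMin lam w) z r) (x y : EllTwo) :
    pairing y (rieszProjection (jacobiMin lam w) z r x) =
      pairing x (rieszProjection (jacobiMin lam w) z r y) := by
  have h : ∀ x y : EllTwo, pairing y (rieszProjection (jacobiMin lam w) z r x) = _ := fun x y =>
    map_rieszProjection hr ((pairing y).comp (ContinuousLinearMap.apply ℂ EllTwo x))
  rw [h x y, h y x]
  congr 1
  refine circleIntegral.integral_congr hr.1.le fun ξ hξ => ?_
  have hR := isResolventAt_iff.1 (resolventOp_spec (hr.mem_resolventSet hξ))
  set R := resolventOp (jacobiMin lam w) ξ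
  change pairing y (R x) = pairing x (R y)
  -- The equality J_min = J_max places both R x and R y in the range of the symmetry relation; the
  -- terms in ξ cancel and leave the symmetry of the resolvent.
  have hsymm := pairing_symm (hR.1 x) (heq ▸ hR.1 y)
  rw [map_add, map_smul, pairing_comm (y + _), map_add, map_smul, pairing_comm (R x) (R y),
    add_left_inj] at hsymm
  rw [pairing_comm y, ← hsymm, pairing_comm]

theorem one_lt_rank_range_rieszProjection (heq : jacobiMin lam w = jacobiMax lam w) {r : ℝ}
    (hr : IsRieszRadius (jacobiMin lam w) z r) {v : EllTwo}
    (hv : (v, z • v) ∈ (jacobiMin lam w).graph) (hv0 : v ≠ 0) (hsq : pairing v v = 0) :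
    1 < algebraicMultiplicity (jacobiMin lam w) z r := by
  by_contra hcon
  rw [not_lt, algebraicMultiplicity, rank_submodule_le_one_iff'] at hcon
  obtain ⟨u, hu⟩ := hcon
  set P := rieszProjection (jacobiMin lam w) z r
  have hPv : P v = v := rieszProjection_apply_eigenvector hr hv
  have hmem : ∀ x, ∃ c : ℂ, c • u = P x := fun x =>
    Submodule.mem_span_singleton.1 (hu ⟨x, rfl⟩)
  obtain ⟨a, ha⟩ := hmem v
  rw [hPv] at ha
  have ha0 : a ≠ 0 := fun h => hv0 (by rw [← ha, h, zero_smul])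
  refine hv0 (lp.ext (funext fun n => ?_))
  obtain ⟨c, hc⟩ := hmem (basisVec n)
  have h1 := pairing_rieszProjection heq hr (basisVec n) v
  change pairing v (P (basisVec n)) = pairing (basisVec n) (P v) at h1
  have h2 : P (basisVec n) = (c / a) • v := by
    rw [← hc, ← ha, smul_smul, div_mul_cancel₀ _ ha0]
  rw [hPv, h2, map_smul, hsq, smul_zero, pairing_comm, pairing_basisVec] at h1
  exact h1.symm

end DoublyInfiniteJacobi

/-! ### The theorem -/

open DoublyInfiniteJacobi in
theorem mainTheorem11 (lam w γ : ℤ → ℂ)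
    (hw : ∀ n, w n ≠ 0)
    (hγ : ∀ n, γ n * γ (n + 1) = w n)
    (hsum : ∃ z₀ ∈ compl0 lam, SummableAt lam w z₀)
    (hF : ∃ z ∈ compl0 lam, charFun lam γ z ≠ 0)
    (hconn : IsConnected (der lam)ᶜ)
    (z : ℂ) (hz : z ∈ compl0 lam)
    (v : EllTwo) (hv : v ∈ eigenspace (jacobiMin lam w) z) (hv0 : v ≠ 0)
    (hsq : ∑' n : ℤ, v n ^ 2 = 0) :
    jacobiMin lam w = jacobiMax lam w ∧
      IsIsolatedSpectralPoint (jacobiMin lam w) z ∧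
      ∀ r : ℝ, IsRieszRadius (jacobiMin lam w) z r →
        geometricMultiplicity (jacobiMin lam w) z <
          algebraicMultiplicity (jacobiMin lam w) z r := by
  obtain ⟨z₀, hz₀, hs⟩ := hsum
  have hv' := mem_eigenspace_iff.1 hv
  have hres : ∀ ξ ∈ compl0 lam, sparseSum (edge lam w ξ) ≠ 0 →
      jacobiMin lam w = jacobiMax lam w ∧ ξ ∈ resolventSet (jacobiMin lam w) := fun ξ hξ hne => by
    obtain ⟨δ, hδ, hle⟩ := exists_le_norm_sub hξ
    exact jacobiMin_eq_jacobiMax hw hδ hle (summable_edge hz₀ hs hξ) hne hv' hv0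
  have hF' : ∃ ξ ∈ compl0 lam, sparseSum (edge lam w ξ) ≠ 0 := by
    obtain ⟨ξ, hξ, hne⟩ := hF
    exact ⟨ξ, hξ, by rwa [← charFun_eq_sparseSum hγ (summable_edge hz₀ hs hξ)]⟩
  have heq : jacobiMin lam w = jacobiMax lam w := by
    obtain ⟨ξ, hξ, hne⟩ := hF'
    exact (hres ξ hξ hne).1
  refine ⟨heq, ⟨?_, ?_⟩, fun r hr => ?_⟩
  · rintro ⟨R, hR⟩
    have := (isResolventAt_iff.1 hR).2 _ _ hv'
    rw [sub_self, map_zero] at this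
    exact hv0 this.symm
  -- Spectral points near z are zeros of F, and these do not accumulate at z.
  · have hev : ∀ᶠ ξ in 𝓝[≠] z, ξ ∈ resolventSet (jacobiMin lam w) := by
      filter_upwards [eventually_sparseSum_edge_ne_zero hconn hz₀ hs hF' hz,
        mem_nhdsWithin_of_mem_nhds (isOpen_compl0.mem_nhds hz)] with ξ h1 h2
      exact (hres ξ h2 h1).2
    obtain ⟨ε, hε, hball⟩ := Metric.mem_nhdsWithin_iff.1 hev
    refine ⟨ε, hε, fun ξ hξ => ?_⟩
    by_contra hne
    exact hξ.2 (hball ⟨hξ.1, hne⟩)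
  · refine (rank_eigenspace_le_one hw).trans_lt
      (one_lt_rank_range_rieszProjection heq hr hv' hv0 ?_)
    rw [pairing_apply, ← hsq]
    exact tsum_congr fun n => (sq _).symm
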